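/- Let $c>0$ and let $L^2[-1,1]$ be the complex Hilbert space of square-integrable functions on $[-1,1]$. Let $\mathcal F_c$ be the finite Fourier transform, the bounded operator on $L^2[-1,1]$ given by $\mathcal F_c[\phi](x)=\int_{-1}^{1}e^{icxt}\phi(t)\,dt$, and let $T$ be the prolate spheroidal (confluent Heun) operator on $L^2[-1,1]$, that is, the closure of the differential operator $(1-x^2)\frac{d^2}{dx^2}-2x\frac{d}{dx}-c^2x^2$ with domain $C^\infty[-1,1]$. Define real polynomials $U_k$, $k\ge 0$, by $U_0=1$ and $$U_{k+1}(\lambda)=\frac{\lambda+c^2+k(k+1)}{2(k+1)}\,U_k(\lambda)-\frac{c^2k}{k+1}\,U_{k-1}(\lambda)+\frac{c^2k(k-1)}{2(k+1)}\,U_{k-2}(\lambda)\qquad(k\ge 0),$$ where the terms with a negative index have coefficient $0$ and are omitted, and put $U(\xi;\lambda)=\sum_{k\ge 0}\frac{\xi^k}{k!}U_k(\lambda)$. Then the following hold. 1. $T$ is self-adjoint and its eigenvectors span a dense subspace of $L^2[-1,1]$. Writing $P_\lambda$ for the orthogonal projection onto the eigenspace of $T$ for the eigenvalue $\lambda$,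 one therefore has $g(T)f=\sum_\lambda g(\lambda)P_\lambda f$ for functions $g$ of $T$, the sum being over the eigenvalues of $T$. 2. The series $U(\xi;\lambda)$ converges absolutely for all $\lambda\in\mathbb R$ and $\xi\in(-2,2)$. 3. For every $\xi\in[0,2)$ the function $U(\xi;T)$ of $T$ is a bounded, everywhere defined operator on $L^2[-1,1]$, and $U(\xi;T)f=\sum_{k\ge 0}\frac{\xi^k}{k!}U_k(T)f$, with convergence in norm, for every finite linear combination $f$ of eigenvectors of $T$. 4. As operators on $L^2[-1,1]$, $$\mathcal F_c=\int_0^2e^{ic(1-\xi)}\,U(\xi;T)\,d\xi,$$ where the integral is taken in the strong sense: for every $f\in L^2[-1,1]$ the function $\xi\mapsto e^{ic(1-\xi)}U(\xi;T)f$ is Bochner integrable on $(0,2)$ with integral $\mathcal F_cf$. 5. In particular, $\mathcal F_c$ is a function of $T$: $\mathcal F_c=g(T)$ with $g(\lambda)=\int_0^2e^{ic(1-\xi)}\,U(\xi;\lambda)\,d\xi$. -/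

import Mathlib

open MeasureTheory

noncomputable section

namespace Prolate

/-- Lebesgue measure on `[-1, 1]`. -/
abbrev μI : Measure ℝ := volume.restrict (Set.Icc (-1) 1)

/-- The complex Hilbert space `L²[-1, 1]`. -/
abbrev L2 : Type := Lp ℂ 2 μI

/-! ### The finite Fourier transform -/

/-- `F_c[φ](x) = ∫_{-1}^{1} e^{icxt} φ(t) dt`, as a function of `x`. -/
def fourierFun (c : ℝ) (φ : ℝ → ℂ) (x : ℝ) : ℂ :=
  ∫ t in Set.Icc (-1 : ℝ) 1, Complex.exp (Complex.I * c * x * t) * φ t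

theorem integrable_L2 (f : L2) : Integrable f μI :=
  (Lp.memLp f).integrable (by norm_num)

theorem norm_kernel (c x t : ℝ) : ‖Complex.exp (Complex.I * c * x * t)‖ = 1 := by
  have h : Complex.I * c * x * t = ((c * x * t : ℝ) : ℂ) * Complex.I := by push_cast; ring
  rw [h, Complex.norm_exp_ofReal_mul_I]

theorem integrable_kernel (c x : ℝ) (f : L2) :
    Integrable (fun t : ℝ => Complex.exp (Complex.I * c * x * t) * f t) μI := by
  refine (integrable_L2 f).bdd_mul (c := 1) ?_ ?_
  · exact (Continuous.aestronglyMeasurable (by fun_prop))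
  · exact Filter.Eventually.of_forall fun t => (norm_kernel c x t).le

theorem continuous_fourierFun (c : ℝ) (f : L2) : Continuous (fourierFun c f) := by
  refine continuous_of_dominated (bound := fun t => ‖f t‖) ?_ ?_ ?_ ?_
  · exact fun x => (integrable_kernel c x f).aestronglyMeasurable
  · exact fun x => Filter.Eventually.of_forall fun t => by rw [norm_mul, norm_kernel, one_mul]
  · exact (integrable_L2 f).norm
  · exact Filter.Eventually.of_forall fun t => by fun_prop

theorem norm_fourierFun_le (c x : ℝ) (f : L2) : ‖fourierFun c f x‖ ≤ ∫ t, ‖f t‖ ∂μI := by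
  refine (norm_integral_le_integral_norm _).trans (le_of_eq ?_)
  exact integral_congr_ae (Filter.Eventually.of_forall fun t => by
    simp only [norm_mul, norm_kernel, one_mul])

theorem memLp_fourierFun (c : ℝ) (f : L2) : MemLp (fourierFun c f) 2 μI :=
  MemLp.of_bound (continuous_fourierFun c f).aestronglyMeasurable _
    (Filter.Eventually.of_forall fun x => norm_fourierFun_le c x f)

theorem integral_norm_le (f : L2) : ∫ t, ‖f t‖ ∂μI ≤ Real.sqrt 2 * ‖f‖ := by
  have h1 : eLpNorm f 1 μI ≤ eLpNorm f 2 μI * μI Set.univ ^ ((1 : ℝ) / 2) := by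
    have := eLpNorm_le_eLpNorm_mul_rpow_measure_univ (μ := μI) (p := 1) (q := 2) (f := f)
      (by norm_num) (Lp.aestronglyMeasurable f)
    refine this.trans (le_of_eq ?_)
    norm_num
  have h2 : μI Set.univ = ENNReal.ofReal 2 := by
    simp only [Measure.restrict_apply_univ, Real.volume_Icc]
    norm_num
  have h3 : ∫ t, ‖f t‖ ∂μI = (eLpNorm f 1 μI).toReal := by
    rw [integral_norm_eq_lintegral_enorm (Lp.aestronglyMeasurable f), eLpNorm_one_eq_lintegral_enorm]
  rw [h3, Lp.norm_def, mul_comm, Real.sqrt_eq_rpow]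
  have h4 := ENNReal.toReal_mono (ENNReal.mul_ne_top (Lp.eLpNorm_ne_top f)
    (by rw [h2]; exact ENNReal.rpow_ne_top_of_nonneg (by norm_num) ENNReal.ofReal_ne_top)) h1
  rw [ENNReal.toReal_mul, h2, ← ENNReal.toReal_rpow, ENNReal.toReal_ofReal (by norm_num)] at h4
  exact h4

theorem fourierFun_congr (c x : ℝ) {f g : ℝ → ℂ} (h : f =ᵐ[μI] g) :
    fourierFun c f x = fourierFun c g x :=
  integral_congr_ae (h.mono fun t ht => by simp only [ht])

/-- The finite Fourier transform `F_c` as a bounded operator on `L²[-1, 1]`. -/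
def finiteFourier (c : ℝ) : L2 →L[ℂ] L2 :=
  LinearMap.mkContinuous
    { toFun := fun f => (memLp_fourierFun c f).toLp (fourierFun c f)
      map_add' := fun f g => by
        rw [← MemLp.toLp_add]
        refine MemLp.toLp_congr _ _ (Filter.Eventually.of_forall fun x => ?_)
        rw [fourierFun_congr c x (Lp.coeFn_add f g), Pi.add_apply]
        simp only [fourierFun, Pi.add_apply, mul_add]
        exact integral_add (integrable_kernel c x f) (integrable_kernel c x g)
      map_smul' := fun a f => by
        rw [RingHom.id_apply, ← MemLp.toLp_const_smul]
        refine MemLp.toLp_congr _ _ (Filter.Eventually.of_forall fun x => ?_)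
        rw [fourierFun_congr c x (Lp.coeFn_smul a f), Pi.smul_apply]
        simp only [fourierFun, Pi.smul_apply, smul_eq_mul, mul_left_comm _ a]
        exact integral_const_mul a _ }
    2 (fun f => by
      have hb : ∀ᵐ x ∂μI, ‖((memLp_fourierFun c f).toLp (fourierFun c f) : L2) x‖
          ≤ Real.sqrt 2 * ‖f‖ := by
        filter_upwards [(memLp_fourierFun c f).coeFn_toLp] with x hx
        rw [hx]
        exact (norm_fourierFun_le c x f).trans (integral_norm_le f)
      have h := Lp.norm_le_of_ae_bound (by positivity) hb
      refine h.trans (le_of_eq ?_)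
      have hm : (measureUnivNNReal μI : ℝ) = 2 := by
        rw [measureUnivNNReal, ENNReal.coe_toNNReal_eq_toReal, Measure.restrict_apply_univ,
          Real.volume_Icc, ENNReal.toReal_ofReal (by norm_num)]
        norm_num
      have he : (2 : ℝ) ^ (2 : ENNReal).toReal⁻¹ = Real.sqrt 2 := by
        rw [Real.sqrt_eq_rpow]
        norm_num
      rw [hm, he, ← mul_assoc, Real.mul_self_sqrt (by norm_num)])

theorem finiteFourier_ae (c : ℝ) (f : L2) : finiteFourier c f =ᵐ[μI] fourierFun c f :=
  (memLp_fourierFun c f).coeFn_toLp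

/-! ### The prolate spheroidal (confluent Heun) operator -/

/-- The differential expression `(1 - x²) φ'' - 2 x φ' - c² x² φ`. -/
def heunExpr (c : ℝ) (φ : ℝ → ℂ) (x : ℝ) : ℂ :=
  (1 - (x : ℂ) ^ 2) * deriv (deriv φ) x - 2 * x * deriv φ x - (c : ℂ) ^ 2 * (x : ℂ) ^ 2 * φ x

theorem heunExpr_add (c : ℝ) {φ ψ : ℝ → ℂ} (hφ : ContDiff ℝ (⊤ : ℕ∞) φ)
    (hψ : ContDiff ℝ (⊤ : ℕ∞) ψ) : heunExpr c (φ + ψ) = heunExpr c φ + heunExpr c ψ := by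
  have d : ∀ {χ : ℝ → ℂ}, ContDiff ℝ (⊤ : ℕ∞) χ → Differentiable ℝ χ :=
    fun h => h.differentiable (by simp)
  have d' : ∀ {χ : ℝ → ℂ}, ContDiff ℝ (⊤ : ℕ∞) χ → Differentiable ℝ (deriv χ) :=
    fun h => (contDiff_infty_iff_deriv.1 h).2.differentiable (by simp)
  have h1 : deriv (φ + ψ) = deriv φ + deriv ψ :=
    funext fun x => deriv_add (d hφ x) (d hψ x)
  funext x
  simp only [heunExpr, h1, Pi.add_apply, deriv_add (d' hφ x) (d' hψ x)]
  ring

theorem heunExpr_smul (c : ℝ) (a : ℂ) (φ : ℝ → ℂ) :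
    heunExpr c (a • φ) = a • heunExpr c φ := by
  have h1 : ∀ χ : ℝ → ℂ, deriv (a • χ) = a • deriv χ := fun χ => funext fun x => by
    exact deriv_const_smul_field a χ
  funext x
  simp only [heunExpr, h1, Pi.smul_apply, smul_eq_mul]
  ring

/-- The graph `{(φ, T φ) : φ ∈ C^∞[-1, 1]}` in `L² × L²`. -/
def heunGraph (c : ℝ) : Submodule ℂ (L2 × L2) where
  carrier := {p | ∃ φ : ℝ → ℂ, ContDiff ℝ (⊤ : ℕ∞) φ ∧ p.1 =ᵐ[μI] φ ∧ p.2 =ᵐ[μI] heunExpr c φ}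
  add_mem' := by
    rintro ⟨u, v⟩ ⟨u', v'⟩ ⟨φ, hφ, h1, h2⟩ ⟨ψ, hψ, h3, h4⟩
    refine ⟨φ + ψ, hφ.add hψ, (Lp.coeFn_add u u').trans (h1.add h3), ?_⟩
    rw [heunExpr_add c hφ hψ]
    exact (Lp.coeFn_add v v').trans (h2.add h4)
  zero_mem' := by
    refine ⟨0, contDiff_const, Lp.coeFn_zero _ _ _, ?_⟩
    have : heunExpr c 0 = 0 := by simpa using heunExpr_smul c 0 0
    rw [this]
    exact Lp.coeFn_zero _ _ _
  smul_mem' := by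
    rintro a ⟨u, v⟩ ⟨φ, hφ, h1, h2⟩
    refine ⟨a • φ, contDiff_const.smul hφ, (Lp.coeFn_smul a u).trans (h1.const_smul a), ?_⟩
    rw [heunExpr_smul]
    exact (Lp.coeFn_smul a v).trans (h2.const_smul a)

theorem heunGraph_single_valued (c : ℝ) :
    ∀ p ∈ heunGraph c, p.1 = 0 → p.2 = 0 := by
  rintro ⟨u, v⟩ ⟨φ, hφ, h1, h2⟩ rfl
  have h0 : φ =ᵐ[volume.restrict (Set.Ioo (-1 : ℝ) 1)] (0 : ℝ → ℂ) := by
    have h : φ =ᵐ[μI] (0 : ℝ → ℂ) := h1.symm.trans (Lp.coeFn_zero _ _ _)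
    exact ae_restrict_of_ae_restrict_of_subset Set.Ioo_subset_Icc_self h
  have hz : Set.EqOn φ 0 (Set.Ioo (-1 : ℝ) 1) :=
    Measure.eqOn_open_of_ae_eq h0 isOpen_Ioo hφ.continuous.continuousOn continuousOn_const
  have hd : Set.EqOn (deriv φ) 0 (Set.Ioo (-1 : ℝ) 1) := fun x hx => by
    have := (hz.eventuallyEq_of_mem (isOpen_Ioo.mem_nhds hx)).deriv_eq
    simpa using this
  have hdd : Set.EqOn (deriv (deriv φ)) 0 (Set.Ioo (-1 : ℝ) 1) := fun x hx => by
    have := (hd.eventuallyEq_of_mem (isOpen_Ioo.mem_nhds hx)).deriv_eq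
    simpa using this
  refine Lp.ext (h2.trans (Filter.EventuallyEq.trans ?_ (Lp.coeFn_zero _ _ _).symm))
  change ∀ᵐ x ∂volume.restrict (Set.Icc (-1 : ℝ) 1), heunExpr c φ x = (0 : ℝ → ℂ) x
  rw [← Measure.restrict_congr_set (Ioo_ae_eq_Icc (μ := volume) (a := (-1 : ℝ)) (b := 1))]
  filter_upwards [ae_restrict_mem measurableSet_Ioo] with x hx
  simp [heunExpr, hz hx, hd hx, hdd hx]

/-- `T` on the domain `C^∞[-1, 1]`. -/
def heunCore (c : ℝ) : L2 →ₗ.[ℂ] L2 := (heunGraph c).toLinearPMap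

theorem heunCore_graph (c : ℝ) : (heunCore c).graph = heunGraph c :=
  Submodule.toLinearPMap_graph_eq _ fun p hp h => heunGraph_single_valued c p hp h

/-- The prolate spheroidal operator `T` on `L²[-1, 1]`: the closure of the differential operator
`(1 - x²) d²/dx² - 2 x d/dx - c² x²` with domain `C^∞[-1, 1]`. -/
def heunOp (c : ℝ) : L2 →ₗ.[ℂ] L2 := (heunCore c).closure

/-! ### Functions of an operator with a complete system of eigenvectors -/

section Calculus

variable {H : Type*} [NormedAddCommGroup H] [InnerProductSpace ℂ H] [CompleteSpace H]

/-- The vectors `f` in the domain of `A` with `A f = l f`. -/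
def eigenspace (A : H →ₗ.[ℂ] H) (l : ℝ) : Submodule ℂ H where
  carrier := {f | ∃ hf : f ∈ A.domain, A ⟨f, hf⟩ = (l : ℂ) • f}
  add_mem' := by
    rintro f g ⟨hf, h1⟩ ⟨hg, h2⟩
    refine ⟨A.domain.add_mem hf hg, ?_⟩
    have := A.map_add ⟨f, hf⟩ ⟨g, hg⟩
    rw [h1, h2, ← smul_add] at this
    exact this
  zero_mem' := ⟨A.domain.zero_mem, by
    rw [smul_zero]
    exact A.map_zero⟩
  smul_mem' := by
    rintro a f ⟨hf, h1⟩
    refine ⟨A.domain.smul_mem a hf, ?_⟩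
    have := A.map_smul a ⟨f, hf⟩
    rw [h1, smul_comm] at this
    exact this

/-- The orthogonal projection onto the (closed) eigenspace of `A` for the eigenvalue `l`;
it is `0` when `l` is not an eigenvalue. -/
def eigenproj (A : H →ₗ.[ℂ] H) (l : ℝ) : H →L[ℂ] H :=
  (eigenspace A l).topologicalClosure.starProjection

/-- The eigenvectors of `A` span a dense subspace: `f = ∑_l P_l f` for every `f`. -/
def HasCompleteEigenvectors (A : H →ₗ.[ℂ] H) : Prop :=
  ∀ f : H, HasSum (fun l : ℝ => eigenproj A l f) f

/-- `B = g(A)` in the functional calculus of a self-adjoint operator `A` with a complete system of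
eigenvectors: `B f = ∑_l g(l) P_l f` for every `f`, the sum being over the eigenvalues of `A`. -/
def IsFunctionOf (A : H →ₗ.[ℂ] H) (g : ℝ → ℂ) (B : H →L[ℂ] H) : Prop :=
  ∀ f : H, HasSum (fun l : ℝ => g l • eigenproj A l f) (B f)

/-- `A f` for `f` in the domain of `A`, and `0` otherwise. -/
def totalApply (A : H →ₗ.[ℂ] H) (f : H) : H :=
  open Classical in if hf : f ∈ A.domain then A ⟨f, hf⟩ else 0

/-- `p(A) f = ∑_j p_j A^j f`; to be used for `f` in a subspace of the domain of `A` that `A` maps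
to itself. -/
def polyApply (A : H →ₗ.[ℂ] H) (p : Polynomial ℝ) (f : H) : H :=
  p.sum fun j a => (a : ℂ) • (totalApply A)^[j] f

/-- The linear span of the eigenvectors of `A` (a subspace of the domain, invariant under `A`). -/
def eigenspan (A : H →ₗ.[ℂ] H) : Submodule ℂ H := ⨆ l : ℝ, eigenspace A l

end Calculus

/-! ### The polynomials `U_k` and the function `U(ξ; l)` -/

open Polynomial in
/-- `U_0 = 1` and the four-term recurrence; for `k = 0` and `k = 1` the terms with a negative index
have coefficient `0`. -/
def polyU (c : ℝ) : ℕ → ℝ[X]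
  | 0 => 1
  | k + 1 =>
      C (1 / (2 * ((k : ℝ) + 1))) * (X + C (c ^ 2 + (k : ℝ) * ((k : ℝ) + 1))) * polyU c k
        - C (c ^ 2 * (k : ℝ) / ((k : ℝ) + 1)) * polyU c (k - 1)
        + C (c ^ 2 * (k : ℝ) * ((k : ℝ) - 1) / (2 * ((k : ℝ) + 1))) * polyU c (k - 2)
termination_by k => k
decreasing_by all_goals omega

/-- The `k`-th term `ξ^k U_k(l) / k!`. -/
def termU (c ξ l : ℝ) (k : ℕ) : ℝ := ξ ^ k * (polyU c k).eval l / (k.factorial : ℝ)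

/-- `U(ξ; l) = ∑_k ξ^k U_k(l) / k!`. -/
def seriesU (c ξ l : ℝ) : ℝ := ∑' k : ℕ, termU c ξ l k

end Prolate

end

/-!
The proof rests on Slepian's observation that the finite Fourier transform `F_c` commutes with the
differential expression of `T`: applied to the kernel `e^{icxt}`, the expression in `x` and the
expression in `t` agree, and Green's identity, whose boundary terms vanish with `1 - x²`, moves it
from the kernel to a smooth function (`heunExpr_fourierFun_comm`).

This gives the spectral theory of `T` without a study of its resolvent. The operator `F_c F_c^*` is
compact, self-adjoint and injective, so its eigenspaces for nonzero eigenvalues are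
finite-dimensional and total. They consist of restrictions of entire functions `F_c φ`, and `T` maps
each of them to itself and is symmetric there; diagonalizing `T` on each of them yields a total
family of eigenvectors of `T` inside its core (`eq_zero_of_forall_isFourierEigenvector`). A closed
symmetric operator with total eigenvectors is self-adjoint (`isSelfAdjoint_of_isSymmetricGraph`),
and its bounded functions are bounded operators (`exists_isFunctionOf`).

If `ψ` is an eigenfunction for `l`, then differentiating the eigenvalue equation `k` times at
`x = 1` shows that `(-1)^k ψ^(k)(1)` satisfies the recurrence of `U_k(l)`. Since `ψ` is entire, it
follows that `ψ(1 - ξ) = ψ(1) U(ξ; l)`: the eigenvalues are simple, every eigenvector of the closure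
`T` is smooth (`exists_isFourierEigenvector`), and `F_c ψ`, being an eigenfunction as well, is the
multiple of `ψ` by `(F_c ψ)(1) / ψ(1) = ∫ e^{ic(1-ξ)} U(ξ; l) dξ`
(`finiteFourier_apply_of_mem_eigenspace`).

What remains is the boundedness of `U(ξ; l)`, uniformly in the eigenvalues `l` and in `ξ ∈ [0, 2]`
(`exists_abs_seriesU_le_of_eigenspace_ne_bot`). Eigenfunctions are even or odd, which reduces it to
`ξ ∈ [0, 1]`. There the recurrence bounds the power series locally uniformly in `l`
(`exists_abs_polyU_le`), the eigenvalues are nonpositive, and for `l < -c²` an energy estimate gives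
`|U(ξ; l)| ≤ 1` (`IsRegularSolution.abs_le_one`). The integral representation then holds on
eigenvectors and extends to all of `L²[-1, 1]` by density.
-/

noncomputable section

namespace Prolate

/-! ### Closed symmetric operators with a total family of eigenvectors -/

section Abstract

variable {H : Type*} [NormedAddCommGroup H] [InnerProductSpace ℂ H]

theorem mem_eigenspace_iff {A : H →ₗ.[ℂ] H} {l : ℝ} {f : H} :
    f ∈ eigenspace A l ↔ (f, (l : ℂ) • f) ∈ A.graph := by
  rw [LinearPMap.mem_graph_iff]
  constructor
  · rintro ⟨hf, h⟩
    exact ⟨⟨f, hf⟩, rfl, h⟩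
  · rintro ⟨⟨y, hy⟩, rfl, h⟩
    exact ⟨hy, h⟩

/-- A graph is symmetric if `⟪A u, v⟫ = ⟪u, A v⟫` for all `(u, A u)` and `(v, A v)` in it. -/
def IsSymmetricGraph (G : Submodule ℂ (H × H)) : Prop :=
  ∀ p ∈ G, ∀ q ∈ G, inner ℂ p.2 q.1 = inner ℂ p.1 q.2

theorem IsSymmetricGraph.topologicalClosure {G : Submodule ℂ (H × H)} (hG : IsSymmetricGraph G) :
    IsSymmetricGraph G.topologicalClosure := by
  have h1 : ∀ p ∈ G.topologicalClosure, ∀ q ∈ G, inner ℂ p.2 q.1 = inner ℂ p.1 q.2 := by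
    intro p hp q hq
    have hc : IsClosed {p : H × H | inner ℂ p.2 q.1 = inner ℂ p.1 q.2} :=
      isClosed_eq (by fun_prop) (by fun_prop)
    exact closure_minimal (fun p hp => hG p hp q hq) hc hp
  intro p hp q hq
  have hc : IsClosed {q : H × H | inner ℂ p.2 q.1 = inner ℂ p.1 q.2} :=
    isClosed_eq (by fun_prop) (by fun_prop)
  exact closure_minimal (fun q hq => h1 p hp q hq) hc hq

theorem isClosed_eigenspace {A : H →ₗ.[ℂ] H} (hA : A.IsClosed) (l : ℝ) :
    IsClosed (eigenspace A l : Set H) := by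
  have h : (eigenspace A l : Set H) =
      (fun f : H => (f, (l : ℂ) • f)) ⁻¹' (A.graph : Set (H × H)) := by
    ext f
    exact mem_eigenspace_iff
  rw [h]
  exact hA.preimage (by fun_prop)

theorem inner_eq_zero_of_mem_eigenspace {A : H →ₗ.[ℂ] H} (hA : IsSymmetricGraph A.graph)
    {l m : ℝ} (hlm : l ≠ m) {f g : H} (hf : f ∈ eigenspace A l) (hg : g ∈ eigenspace A m) :
    inner ℂ f g = 0 := by
  have h := hA _ (mem_eigenspace_iff.1 hf) _ (mem_eigenspace_iff.1 hg)
  simp only [inner_smul_left, inner_smul_right, Complex.conj_ofReal] at h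
  have h2 : ((l : ℂ) - m) * inner ℂ f g = 0 := by rw [sub_mul, h, sub_self]
  rcases mul_eq_zero.1 h2 with h3 | h3
  · exact absurd (by exact_mod_cast sub_eq_zero.1 h3) hlm
  · exact h3

theorem orthogonalFamily_eigenspace {A : H →ₗ.[ℂ] H} (hA : IsSymmetricGraph A.graph) :
    OrthogonalFamily ℂ (fun l : ℝ => eigenspace A l) fun l => (eigenspace A l).subtypeₗᵢ :=
  fun _ _ hlm f g => inner_eq_zero_of_mem_eigenspace hA hlm f.2 g.2

theorem eigenspace_mono {A B : H →ₗ.[ℂ] H} (h : A ≤ B) (l : ℝ) :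
    eigenspace A l ≤ eigenspace B l := fun _ hf =>
  mem_eigenspace_iff.2 (LinearPMap.le_graph_of_le h (mem_eigenspace_iff.1 hf))

theorem totalApply_of_mem_eigenspace {A : H →ₗ.[ℂ] H} {l : ℝ} {f : H}
    (hf : f ∈ eigenspace A l) : totalApply A f = (l : ℂ) • f := by
  obtain ⟨h1, h2⟩ := hf
  rw [totalApply, dif_pos h1, h2]

theorem totalApply_add {A : H →ₗ.[ℂ] H} {f g : H} (hf : f ∈ A.domain) (hg : g ∈ A.domain) :
    totalApply A (f + g) = totalApply A f + totalApply A g := by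
  rw [totalApply, totalApply, totalApply, dif_pos hf, dif_pos hg, dif_pos (add_mem hf hg)]
  exact A.map_add ⟨f, hf⟩ ⟨g, hg⟩

theorem eigenspan_le_domain (A : H →ₗ.[ℂ] H) : eigenspan A ≤ A.domain :=
  iSup_le fun _ _ hf => hf.1

theorem totalApply_mem_eigenspan {A : H →ₗ.[ℂ] H} {f : H} (hf : f ∈ eigenspan A) :
    totalApply A f ∈ eigenspan A := by
  suffices h : f ∈ A.domain ∧ totalApply A f ∈ eigenspan A from h.2
  refine Submodule.iSup_induction _ (motive := fun f => f ∈ A.domain ∧ totalApply A f ∈ eigenspan A)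
    hf (fun l f hf => ⟨hf.1, ?_⟩) ⟨A.domain.zero_mem, ?_⟩ (fun f g hf hg => ⟨add_mem hf.1 hg.1, ?_⟩)
  · rw [totalApply_of_mem_eigenspace hf]
    exact Submodule.smul_mem _ _ (Submodule.mem_iSup_of_mem l hf)
  · rw [totalApply_of_mem_eigenspace (eigenspace A 0).zero_mem, smul_zero]
    exact Submodule.zero_mem _
  · rw [totalApply_add hf.1 hg.1]
    exact add_mem hf.2 hg.2

theorem iterate_totalApply_add {A : H →ₗ.[ℂ] H} (j : ℕ) :
    ∀ {f g : H}, f ∈ eigenspan A → g ∈ eigenspan A →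
    (totalApply A)^[j] (f + g) = (totalApply A)^[j] f + (totalApply A)^[j] g := by
  induction j with
  | zero => intros; rfl
  | succ j ih =>
    intro f g hf hg
    simp only [Function.iterate_succ_apply]
    rw [totalApply_add (eigenspan_le_domain A hf) (eigenspan_le_domain A hg)]
    exact ih (totalApply_mem_eigenspan hf) (totalApply_mem_eigenspan hg)

theorem polyApply_add {A : H →ₗ.[ℂ] H} (p : Polynomial ℝ) {f g : H} (hf : f ∈ eigenspan A)
    (hg : g ∈ eigenspan A) : polyApply A p (f + g) = polyApply A p f + polyApply A p g := by
  simp only [polyApply, Polynomial.sum, iterate_totalApply_add _ hf hg, smul_add,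
    Finset.sum_add_distrib]

theorem polyApply_of_mem_eigenspace {A : H →ₗ.[ℂ] H} (p : Polynomial ℝ) {l : ℝ} {f : H}
    (hf : f ∈ eigenspace A l) : polyApply A p f = ((p.eval l : ℝ) : ℂ) • f := by
  have h : ∀ j : ℕ, (totalApply A)^[j] f = ((l : ℂ) ^ j) • f := by
    intro j
    induction j with
    | zero => simp
    | succ j ih =>
      rw [Function.iterate_succ_apply', ih,
        totalApply_of_mem_eigenspace (Submodule.smul_mem _ _ hf), smul_smul, pow_succ']
  rw [polyApply, Polynomial.eval_eq_sum, Polynomial.sum, Polynomial.sum]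
  simp only [h, smul_smul]
  push_cast
  rw [Finset.sum_smul]

variable [CompleteSpace H]

/-- The domain contains the eigenvectors, so it is dense when they are total. -/
theorem dense_of_orthogonal_eigenspan {A : H →ₗ.[ℂ] H} (h : (eigenspan A)ᗮ = ⊥) :
    Dense (A.domain : Set H) := by
  have h1 : Dense (eigenspan A : Set H) := by
    rw [Submodule.dense_iff_topologicalClosure_eq_top,
      Submodule.topologicalClosure_eq_top_iff, h]
  exact h1.mono (eigenspan_le_domain A)

/-- A densely defined symmetric operator is contained in its adjoint, which is closed. -/
theorem isClosable_of_isSymmetricGraph {A : H →ₗ.[ℂ] H} (hA : IsSymmetricGraph A.graph)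
    (hd : Dense (A.domain : Set H)) : A.IsClosable := by
  have hf : A.IsFormalAdjoint A := fun x y =>
    hA _ (A.mem_graph x) _ (A.mem_graph y)
  exact (LinearPMap.adjoint_isClosed hd).isClosable.leIsClosable
    (LinearPMap.IsFormalAdjoint.le_adjoint hd hf)

section Closed

variable {A : H →ₗ.[ℂ] H} (hA : IsSymmetricGraph A.graph) (hc : A.IsClosed)
  (hd : (eigenspan A)ᗮ = ⊥)

include hc in
theorem eigenproj_mem (l : ℝ) (f : H) : eigenproj A l f ∈ eigenspace A l := by
  have h : (eigenspace A l).topologicalClosure = eigenspace A l :=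
    (isClosed_eigenspace hc l).submodule_topologicalClosure_eq
  have h2 : eigenproj A l f ∈ (eigenspace A l).topologicalClosure :=
    Submodule.starProjection_apply_mem _ _
  exact h ▸ h2

theorem eigenproj_apply_self {l : ℝ} {f : H} (hf : f ∈ eigenspace A l) :
    eigenproj A l f = f :=
  Submodule.starProjection_eq_self_iff.2 (Submodule.le_topologicalClosure _ hf)

theorem inner_eigenproj {l : ℝ} {e : H} (he : e ∈ eigenspace A l) (f : H) :
    inner ℂ e (eigenproj A l f) = inner ℂ e f := by
  have h := Submodule.inner_starProjection_left_eq_right (eigenspace A l).topologicalClosure e f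
  change inner ℂ (eigenproj A l e) f = inner ℂ e (eigenproj A l f) at h
  rw [← h, eigenproj_apply_self he]

include hA hc in
theorem eigenproj_apply_of_ne {l m : ℝ} (hlm : l ≠ m) {f : H} (hf : f ∈ eigenspace A m) :
    eigenproj A l f = 0 := by
  have h1 := eigenproj_mem hc l f
  rw [← inner_self_eq_zero (𝕜 := ℂ), inner_eigenproj h1]
  exact inner_eq_zero_of_mem_eigenspace hA hlm h1 hf

include hA hc hd in
theorem hasCompleteEigenvectors_of_isSymmetricGraph : HasCompleteEigenvectors A := by
  have : ∀ l, CompleteSpace (eigenspace A l) := fun l =>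
    (isClosed_eigenspace hc l).completeSpace_coe
  have hs : IsHilbertSum ℂ (fun l : ℝ => eigenspace A l) fun l => (eigenspace A l).subtypeₗᵢ :=
    IsHilbertSum.mkInternal (fun l => eigenspace A l) (orthogonalFamily_eigenspace hA)
      (by rw [top_le_iff, Submodule.topologicalClosure_eq_top_iff]; exact hd)
  intro f
  have h := hs.hasSum_linearIsometryEquiv_symm (hs.linearIsometryEquiv f)
  rw [LinearIsometryEquiv.symm_apply_apply] at h
  convert h using 2 with l
  have h2 := h.mapL (eigenproj A l)
  have h3 := hasSum_single (f := fun m => eigenproj A l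
    ((eigenspace A m).subtypeₗᵢ (hs.linearIsometryEquiv f m))) l
    (fun m hm => eigenproj_apply_of_ne hA hc hm.symm (Subtype.prop _))
  rw [h2.unique h3]
  exact eigenproj_apply_self (Subtype.prop _)

include hA hc hd in
/-- A closed symmetric operator with a total family of eigenvectors is self-adjoint: if `(u, v)`
lies in the graph of the adjoint, then `P_l v = l P_l u` for every `l`, so that `(u, v)` is the limit
of finite sums of the pairs `(P_l u, l P_l u)` of the graph of `A`. -/
theorem isSelfAdjoint_of_isSymmetricGraph : IsSelfAdjoint A := by
  have hdom := dense_of_orthogonal_eigenspan hd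
  have hcomp := hasCompleteEigenvectors_of_isSymmetricGraph hA hc hd
  rw [LinearPMap.isSelfAdjoint_def]
  refine le_antisymm ?_ (LinearPMap.IsFormalAdjoint.le_adjoint hdom fun x y =>
    hA _ (A.mem_graph x) _ (A.mem_graph y))
  refine LinearPMap.le_of_le_graph ?_
  rintro ⟨u, v⟩ huv
  rw [LinearPMap.adjoint_graph_eq_graph_adjoint hdom, Submodule.mem_adjoint_iff] at huv
  have key : ∀ l : ℝ, eigenproj A l v = (l : ℂ) • eigenproj A l u := by
    intro l
    have hm : eigenproj A l v - (l : ℂ) • eigenproj A l u ∈ eigenspace A l :=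
      Submodule.sub_mem _ (eigenproj_mem hc l v) (Submodule.smul_mem _ _ (eigenproj_mem hc l u))
    have h := huv _ _ (mem_eigenspace_iff.1 hm)
    rw [← sub_eq_zero, ← inner_self_eq_zero (𝕜 := ℂ)]
    set e := eigenproj A l v - (l : ℂ) • eigenproj A l u with he
    nth_rewrite 2 [he]
    rw [inner_sub_right, inner_smul_right, inner_eigenproj hm, inner_eigenproj hm]
    simp only [inner_smul_left, Complex.conj_ofReal] at h
    linear_combination -h
  have h1 : HasSum (fun l : ℝ => (eigenproj A l u, (l : ℂ) • eigenproj A l u)) (u, v) := by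
    refine HasSum.prodMk (hcomp u) ?_
    have := hcomp v
    simpa only [key] using this
  exact hc.mem_of_tendsto h1 (Filter.Eventually.of_forall fun s =>
    Submodule.sum_mem _ fun l _ => mem_eigenspace_iff.1 (eigenproj_mem hc l u))

include hA hc hd in
/-- `g(A)` is bounded by `C` if `|g| ≤ C` on the eigenvalues of `A`. -/
theorem exists_isFunctionOf {g : ℝ → ℂ} {C : ℝ} (hC : 0 ≤ C)
    (hg : ∀ l, eigenspace A l ≠ ⊥ → ‖g l‖ ≤ C) :
    ∃ B : H →L[ℂ] H, IsFunctionOf A g B ∧ ∀ f, ‖B f‖ ≤ C * ‖f‖ := by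
  have hcomp := hasCompleteEigenvectors_of_isSymmetricGraph hA hc hd
  have hO := orthogonalFamily_eigenspace hA
  have hle : ∀ f l, ‖g l • eigenproj A l f‖ ≤ C * ‖eigenproj A l f‖ := by
    intro f l
    by_cases h : eigenspace A l = ⊥
    · have h2 := eigenproj_mem hc l f
      rw [h, Submodule.mem_bot] at h2
      simp [h2]
    · rw [norm_smul]
      exact mul_le_mul_of_nonneg_right (hg l h) (norm_nonneg _)
  let e : H → ∀ l : ℝ, eigenspace A l := fun f l => ⟨eigenproj A l f, eigenproj_mem hc l f⟩
  have hsq : ∀ f, Summable fun l => ‖e f l‖ ^ 2 := fun f =>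
    (hO.summable_iff_norm_sq_summable (e f)).1 (hcomp f).summable
  have hsum : ∀ f, Summable fun l => g l • eigenproj A l f := by
    intro f
    refine (hO.summable_iff_norm_sq_summable fun l => g l • e f l).2 ?_
    refine Summable.of_nonneg_of_le (fun l => by positivity) (fun l => ?_)
      ((hsq f).mul_left (C ^ 2))
    rw [← mul_pow]
    exact pow_le_pow_left₀ (norm_nonneg _) (hle f l) 2
  have hbound : ∀ f, ‖∑' l, g l • eigenproj A l f‖ ≤ C * ‖f‖ := by
    intro f
    have hfin : ∀ s : Finset ℝ, ‖∑ l ∈ s, g l • eigenproj A l f‖ ≤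
        C * ‖∑ l ∈ s, eigenproj A l f‖ := by
      intro s
      refine pow_le_pow_iff_left₀ (norm_nonneg _) (by positivity) two_ne_zero |>.1 ?_
      rw [mul_pow]
      have h1 := hO.norm_sum (fun l => g l • e f l) s
      have h2 := hO.norm_sum (e f) s
      change ‖∑ l ∈ s, g l • eigenproj A l f‖ ^ 2 = _ at h1
      change ‖∑ l ∈ s, eigenproj A l f‖ ^ 2 = _ at h2
      rw [h1, h2, Finset.mul_sum]
      refine Finset.sum_le_sum fun l _ => ?_
      rw [← mul_pow]
      exact pow_le_pow_left₀ (norm_nonneg _) (hle f l) 2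
    exact le_of_tendsto_of_tendsto (hsum f).hasSum.norm ((hcomp f).norm.const_mul C)
      (Filter.Eventually.of_forall hfin)
  refine ⟨LinearMap.mkContinuous
    { toFun := fun f => ∑' l, g l • eigenproj A l f
      map_add' := fun f f' => by
        simp only [map_add, smul_add]
        exact (hsum f).tsum_add (hsum f')
      map_smul' := fun a f => by
        simp only [map_smul, RingHom.id_apply, smul_comm _ a]
        exact (hsum f).tsum_const_smul a } C hbound, fun f => (hsum f).hasSum, hbound⟩

end Closed

theorem IsFunctionOf.apply_of_mem_eigenspace {A : H →ₗ.[ℂ] H} (hA : IsSymmetricGraph A.graph)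
    (hc : A.IsClosed) {g : ℝ → ℂ} {B : H →L[ℂ] H} (hB : IsFunctionOf A g B) {l : ℝ} {f : H}
    (hf : f ∈ eigenspace A l) : B f = g l • f := by
  have h := hasSum_single (f := fun m => g m • eigenproj A m f) l
    (fun m hm => by rw [eigenproj_apply_of_ne hA hc hm hf, smul_zero])
  rw [(hB f).unique h, eigenproj_apply_self hf]

/-- A bounded operator acting as `g(l)` on each eigenspace is `g(A)`. -/
theorem isFunctionOf_of_forall_mem_eigenspace {A : H →ₗ.[ℂ] H} (hc : A.IsClosed)
    (hcomp : HasCompleteEigenvectors A) {g : ℝ → ℂ} {B : H →L[ℂ] H}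
    (hB : ∀ l, ∀ f ∈ eigenspace A l, B f = g l • f) : IsFunctionOf A g B := by
  intro f
  have h := (hcomp f).mapL B
  simpa only [fun l => hB l _ (eigenproj_mem hc l f)] using h

end Abstract

/-! ### Calculus of the finite Fourier transform -/

theorem integrable_continuous_mul {g φ : ℝ → ℂ} (hg : Continuous g) (hφ : Integrable φ μI) :
    Integrable (fun t => g t * φ t) μI :=
  IntegrableOn.continuousOn_mul hg.continuousOn hφ isCompact_Icc

theorem integrable_of_continuous {φ : ℝ → ℂ} (hφ : Continuous φ) : Integrable φ μI :=
  hφ.continuousOn.integrableOn_compact isCompact_Icc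

theorem ae_abs_le_one : ∀ᵐ t ∂μI, |t| ≤ 1 := by
  filter_upwards [ae_restrict_mem measurableSet_Icc] with t ht using abs_le.2 ht

theorem hasDerivAt_fourierFun (c : ℝ) {φ : ℝ → ℂ} (hφ : Integrable φ μI) (x : ℝ) :
    HasDerivAt (fourierFun c φ) (fourierFun c (fun t => Complex.I * c * t * φ t) x) x := by
  have hK : ∀ x : ℝ, Continuous fun t : ℝ => Complex.exp (Complex.I * c * x * t) :=
    fun x => by fun_prop
  refine (hasDerivAt_integral_of_dominated_loc_of_deriv_le (bound := fun t => |c| * ‖φ t‖)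
    (F := fun x t => Complex.exp (Complex.I * c * (x : ℝ) * (t : ℝ)) * φ t)
    (F' := fun x t => Complex.exp (Complex.I * c * x * t) * (Complex.I * c * t * φ t))
    (s := Set.univ) Filter.univ_mem ?_ (integrable_continuous_mul (hK x) hφ) ?_ ?_
    (hφ.norm.const_mul _) ?_).2
  · exact Filter.Eventually.of_forall fun x => (integrable_continuous_mul (hK x) hφ).1
  · exact (integrable_continuous_mul (hK x) (integrable_continuous_mul (by fun_prop) hφ)).1
  · filter_upwards [ae_abs_le_one] with t ht x _
    rw [norm_mul, norm_kernel, one_mul, norm_mul, norm_mul, norm_mul, Complex.norm_I, one_mul,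
      Complex.norm_real, Complex.norm_real, Real.norm_eq_abs, Real.norm_eq_abs]
    exact mul_le_mul_of_nonneg_right (mul_le_of_le_one_right (abs_nonneg c) ht) (norm_nonneg _)
  · refine Filter.Eventually.of_forall fun t x _ => ?_
    have h1 : HasDerivAt (fun x : ℝ => Complex.I * c * x * t) (Complex.I * c * 1 * t) x :=
      ((Complex.ofRealCLM.hasDerivAt (x := x)).const_mul (Complex.I * (c : ℂ))).mul_const (t : ℂ)
    refine (h1.cexp.mul_const (φ t)).congr_deriv ?_
    ring

/-- The `k`-th derivative of the finite Fourier transform. -/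
def fourierDeriv (c : ℝ) (φ : ℝ → ℂ) (k : ℕ) : ℝ → ℂ :=
  fourierFun c fun t => (Complex.I * c * t) ^ k * φ t

theorem fourierDeriv_zero (c : ℝ) (φ : ℝ → ℂ) : fourierDeriv c φ 0 = fourierFun c φ := by
  simp only [fourierDeriv, pow_zero, one_mul]

theorem hasDerivAt_fourierDeriv (c : ℝ) {φ : ℝ → ℂ} (hφ : Integrable φ μI) (k : ℕ) (x : ℝ) :
    HasDerivAt (fourierDeriv c φ k) (fourierDeriv c φ (k + 1) x) x := by
  have h := hasDerivAt_fourierFun c (φ := fun t => (Complex.I * c * t) ^ k * φ t)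
    (integrable_continuous_mul (by fun_prop) hφ) x
  simpa only [fourierDeriv, pow_succ', mul_assoc] using h

theorem deriv_fourierDeriv (c : ℝ) {φ : ℝ → ℂ} (hφ : Integrable φ μI) (k : ℕ) :
    deriv (fourierDeriv c φ k) = fourierDeriv c φ (k + 1) :=
  funext fun x => (hasDerivAt_fourierDeriv c hφ k x).deriv

theorem deriv_fourierFun (c : ℝ) {φ : ℝ → ℂ} (hφ : Integrable φ μI) :
    deriv (fourierFun c φ) = fourierDeriv c φ 1 := by
  rw [← fourierDeriv_zero, deriv_fourierDeriv c hφ]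

theorem contDiff_fourierFun (c : ℝ) {φ : ℝ → ℂ} (hφ : Integrable φ μI) :
    ContDiff ℝ (⊤ : ℕ∞) (fourierFun c φ) := by
  have h : ∀ n k : ℕ, ContDiff ℝ n (fourierDeriv c φ k) := by
    intro n
    induction n with
    | zero =>
      intro k
      exact contDiff_zero.2 (continuous_iff_continuousAt.2 fun x =>
        (hasDerivAt_fourierDeriv c hφ k x).continuousAt)
    | succ n ih =>
      intro k
      push_cast
      refine contDiff_succ_iff_deriv.2 ⟨fun x =>
        (hasDerivAt_fourierDeriv c hφ k x).differentiableAt, by simp, ?_⟩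
      rw [deriv_fourierDeriv c hφ]
      exact ih _
  rw [← fourierDeriv_zero]
  exact contDiff_infty.2 fun n => h n 0

theorem heunExpr_fourierFun (c d : ℝ) {φ : ℝ → ℂ} (hφ : Integrable φ μI) (x : ℝ) :
    heunExpr d (fourierFun c φ) x = (1 - (x : ℂ) ^ 2) * fourierDeriv c φ 2 x
      - 2 * x * fourierDeriv c φ 1 x - (d : ℂ) ^ 2 * (x : ℂ) ^ 2 * fourierDeriv c φ 0 x := by
  rw [heunExpr, deriv_fourierFun c hφ, deriv_fourierDeriv c hφ, fourierDeriv_zero]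

/-- The finite Fourier transform of an integrable function is entire; this is its Taylor series
at the point `a`. -/
theorem hasSum_fourierFun_add (c : ℝ) {φ : ℝ → ℂ} (hφ : Integrable φ μI) (a h : ℝ) :
    HasSum (fun k : ℕ => (h : ℂ) ^ k / (k.factorial : ℂ) * fourierDeriv c φ k a)
      (fourierFun c φ (a + h)) := by
  have hs := hasSum_integral_of_dominated_convergence (μ := μI)
    (F := fun (k : ℕ) (t : ℝ) => (h : ℂ) ^ k / (k.factorial : ℂ) *
      (Complex.exp (Complex.I * c * (a : ℝ) * t) * ((Complex.I * c * t) ^ k * φ t)))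
    (f := fun t => Complex.exp (Complex.I * c * (a + h : ℝ) * t) * φ t)
    (fun k t => (|h| * |c|) ^ k / (k.factorial : ℝ) * ‖φ t‖) ?_ ?_ ?_ ?_ ?_
  · simpa only [fourierDeriv, fourierFun, integral_const_mul] using hs
  · intro k
    exact ((integrable_continuous_mul (by fun_prop)
      (integrable_continuous_mul (by fun_prop) hφ)).const_mul _).1
  · intro k
    filter_upwards [ae_abs_le_one] with t ht
    simp only [norm_mul, norm_kernel, one_mul, norm_div, norm_pow, Complex.norm_I,
      Complex.norm_real, Complex.norm_natCast, Real.norm_eq_abs]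
    rw [← mul_assoc, div_mul_eq_mul_div, ← mul_pow]
    gcongr
    exact mul_le_of_le_one_right (abs_nonneg c) ht
  · exact Filter.Eventually.of_forall fun t =>
      (Real.summable_pow_div_factorial (|h| * |c|)).mul_right _
  · simp only [tsum_mul_right]
    exact hφ.norm.const_mul _
  · refine Filter.Eventually.of_forall fun t => ?_
    have h1 := (NormedSpace.expSeries_div_hasSum_exp (𝔸 := ℂ) ((h : ℂ) * (Complex.I * c * t)))
    rw [← Complex.exp_eq_exp_ℂ] at h1
    have h2 := (h1.mul_left (Complex.exp (Complex.I * c * (a : ℝ) * t))).mul_right (φ t)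
    rw [← Complex.exp_add] at h2
    have e : Complex.I * c * (a + h : ℝ) * t =
        Complex.I * c * (a : ℝ) * t + (h : ℂ) * (Complex.I * c * t) := by
      push_cast
      ring
    rw [e]
    refine h2.congr_fun fun k => ?_
    rw [mul_pow]
    ring

/-! ### Green's identity and the commutation of `F_c` with the differential expression -/

theorem continuous_heunExpr (c : ℝ) {φ : ℝ → ℂ} (hφ : ContDiff ℝ (⊤ : ℕ∞) φ) :
    Continuous (heunExpr c φ) := by
  have h0 := hφ.continuous
  have h1 := (contDiff_infty_iff_deriv.1 hφ).2
  have h2 := (contDiff_infty_iff_deriv.1 h1).2.continuous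
  have h1 := h1.continuous
  unfold heunExpr
  fun_prop

/-- The differential expression is formally symmetric; the boundary terms vanish with `1 - x²`. -/
theorem integral_heunExpr_mul (c : ℝ) {φ ψ : ℝ → ℂ} (hφ : ContDiff ℝ (⊤ : ℕ∞) φ)
    (hψ : ContDiff ℝ (⊤ : ℕ∞) ψ) :
    ∫ t, heunExpr c φ t * ψ t ∂μI = ∫ t, φ t * heunExpr c ψ t ∂μI := by
  have hφ1 := contDiff_infty_iff_deriv.1 hφ
  have hφ2 := contDiff_infty_iff_deriv.1 hφ1.2
  have hψ1 := contDiff_infty_iff_deriv.1 hψ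
  have hψ2 := contDiff_infty_iff_deriv.1 hψ1.2
  have hc1 : Continuous fun t => heunExpr c φ t * ψ t :=
    (continuous_heunExpr c hφ).mul hψ.continuous
  have hc2 : Continuous fun t => φ t * heunExpr c ψ t :=
    hφ.continuous.mul (continuous_heunExpr c hψ)
  rw [← sub_eq_zero, ← integral_sub (integrable_of_continuous hc1) (integrable_of_continuous hc2)]
  have hd : ∀ t : ℝ, HasDerivAt
      (fun t : ℝ => (1 - (t : ℂ) ^ 2) * (deriv φ t * ψ t - φ t * deriv ψ t))
      (heunExpr c φ t * ψ t - φ t * heunExpr c ψ t) t := by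
    intro t
    have h1 : HasDerivAt (fun t : ℝ => 1 - (t : ℂ) ^ 2) (-(2 * (t : ℂ))) t := by
      have := ((Complex.ofRealCLM.hasDerivAt (x := t)).fun_pow 2).const_sub 1
      simpa using this
    have h2 := ((hφ2.1 t).hasDerivAt.mul (hψ1.1 t).hasDerivAt).sub
      ((hφ1.1 t).hasDerivAt.mul (hψ2.1 t).hasDerivAt)
    refine (h1.mul h2).congr_deriv ?_
    simp only [heunExpr, Pi.sub_apply, Pi.mul_apply]
    ring
  rw [integral_Icc_eq_integral_Ioc, ← intervalIntegral.integral_of_le (by norm_num),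
    intervalIntegral.integral_eq_sub_of_hasDerivAt (fun t _ => hd t)
      ((hc1.sub hc2).intervalIntegrable _ _)]
  norm_num

/-- The kernel `e^{icxt}` is annihilated by the difference of the two copies of the differential
expression in `x` and in `t`, so `F_c` intertwines the expression with itself. -/
theorem heunExpr_fourierFun_comm (c : ℝ) {φ : ℝ → ℂ} (hφ : ContDiff ℝ (⊤ : ℕ∞) φ) (x : ℝ) :
    heunExpr c (fourierFun c φ) x = fourierFun c (heunExpr c φ) x := by
  have hi := integrable_of_continuous hφ.continuous
  have hK : ContDiff ℝ (⊤ : ℕ∞) fun t : ℝ => Complex.exp (Complex.I * c * x * t) := by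
    have h : ContDiff ℝ (⊤ : ℕ∞) fun t : ℝ => (t : ℂ) := Complex.ofRealCLM.contDiff
    exact (contDiff_const.mul h).cexp
  have hg := integral_heunExpr_mul c hK hφ
  have hK1 : ∀ a : ℂ, deriv (fun t : ℝ => a * Complex.exp (Complex.I * c * x * t)) =
      fun t : ℝ => (a * (Complex.I * c * x)) * Complex.exp (Complex.I * c * x * t) := by
    intro a
    funext t
    have h1 : HasDerivAt (fun t : ℝ => Complex.I * c * x * t) (Complex.I * c * x * 1) t :=
      (Complex.ofRealCLM.hasDerivAt (x := t)).const_mul (Complex.I * (c : ℂ) * x)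
    rw [(h1.cexp.const_mul a).deriv]
    ring
  have hKd : deriv (fun t : ℝ => Complex.exp (Complex.I * c * x * t)) =
      fun t : ℝ => (Complex.I * c * x) * Complex.exp (Complex.I * c * x * t) := by
    have h := hK1 1
    simp only [one_mul] at h
    exact h
  rw [fourierFun, ← hg, heunExpr_fourierFun c c hi]
  simp only [fourierDeriv, fourierFun, ← integral_const_mul]
  rw [← integral_sub, ← integral_sub]
  · refine integral_congr_ae (Filter.Eventually.of_forall fun t => ?_)
    simp only [heunExpr, hKd, hK1]
    linear_combination (Complex.exp (Complex.I * c * x * t) * φ t * c ^ 2 * (t ^ 2 - x ^ 2)) *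
      Complex.I_sq
  · refine Integrable.sub ?_ ?_ <;> exact (integrable_continuous_mul (by fun_prop)
      (integrable_continuous_mul (by fun_prop) hi)).const_mul _
  · exact (integrable_continuous_mul (by fun_prop)
      (integrable_continuous_mul (by fun_prop) hi)).const_mul _
  · exact (integrable_continuous_mul (by fun_prop)
      (integrable_continuous_mul (by fun_prop) hi)).const_mul _
  · exact (integrable_continuous_mul (by fun_prop)
      (integrable_continuous_mul (by fun_prop) hi)).const_mul _

/-! ### Taylor coefficients of smooth eigenfunctions at the endpoint -/

/-- The eigenvalue equation differentiated `k` times. For `k ≤ 1` the truncated indices `k - 1`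
and `k - 2` come with the coefficient `0`. -/
theorem heun_iterated_deriv {D : ℕ → ℝ → ℂ} (hD : ∀ k x, HasDerivAt (D k) (D (k + 1) x) x)
    {c l : ℂ} (h0 : ∀ x ∈ Set.Ioo (-1 : ℝ) 1, (1 - (x : ℂ) ^ 2) * D 2 x - 2 * x * D 1 x
      - c ^ 2 * (x : ℂ) ^ 2 * D 0 x = l * D 0 x) (k : ℕ) :
    ∀ x ∈ Set.Ioo (-1 : ℝ) 1, (1 - (x : ℂ) ^ 2) * D (k + 2) x - 2 * (k + 1) * (x * D (k + 1) x)
      - k * (k + 1) * D k x - c ^ 2 * ((x : ℂ) ^ 2 * D k x + 2 * (x * (k * D (k - 1) x))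
        + k * (k - 1) * D (k - 2) x) = l * D k x := by
  induction k with
  | zero =>
    intro x hx
    have := h0 x hx
    simp only [Nat.cast_zero, zero_mul, mul_zero, add_zero, zero_add, sub_zero, mul_one]
    rw [← this]
    ring
  | succ k ih =>
    intro x hx
    have hx1 : HasDerivAt (fun t : ℝ => (t : ℂ)) 1 x := Complex.ofRealCLM.hasDerivAt
    have hx2 : HasDerivAt (fun t : ℝ => (t : ℂ) ^ 2) (2 * (x : ℂ)) x := by
      simpa using hx1.fun_pow 2
    have e1 : HasDerivAt (fun x => (k : ℂ) * D (k - 1) x) (k * D k x) x := by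
      cases k with
      | zero => simpa using hasDerivAt_const x (0 : ℂ)
      | succ j => exact (hD j x).const_mul _
    have e2 : HasDerivAt (fun x => (k : ℂ) * (k - 1) * D (k - 2) x)
        (k * (k - 1) * D (k - 1) x) x := by
      match k with
      | 0 => simpa using hasDerivAt_const x (0 : ℂ)
      | 1 => simpa using hasDerivAt_const x (0 : ℂ)
      | j + 2 => exact (hD j x).const_mul _
    have hL := (((hx2.const_sub 1).mul (hD (k + 2) x)).sub
      ((hx1.mul (hD (k + 1) x)).const_mul (2 * ((k : ℂ) + 1)))).sub
      ((hD k x).const_mul ((k : ℂ) * (k + 1))) |>.sub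
      ((((hx2.mul (hD k x)).add ((hx1.mul e1).const_mul 2)).add e2).const_mul (c ^ 2))
    have hR := (hD k x).const_mul l
    have he := hL.congr_of_eventuallyEq
      (Filter.eventually_of_mem (isOpen_Ioo.mem_nhds hx) fun y hy => (ih y hy).symm)
    have hu := he.unique hR
    have e3 : k + 1 - 2 = k - 1 := by omega
    rw [e3, Nat.add_sub_cancel]
    push_cast
    rw [← hu]
    ring

theorem polyU_succ (c : ℝ) (k : ℕ) (l : ℝ) :
    2 * ((k : ℝ) + 1) * (polyU c (k + 1)).eval l = (l + (c ^ 2 + k * (k + 1))) * (polyU c k).eval l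
      - 2 * c ^ 2 * k * (polyU c (k - 1)).eval l
      + c ^ 2 * k * (k - 1) * (polyU c (k - 2)).eval l := by
  rw [polyU]
  simp only [Polynomial.eval_add, Polynomial.eval_sub, Polynomial.eval_mul, Polynomial.eval_C,
    Polynomial.eval_X]
  have : (k : ℝ) + 1 ≠ 0 := by positivity
  field_simp

/-- At `x = 1` the differentiated equations become the recurrence for `U_k`. -/
theorem iterated_deriv_one {D : ℕ → ℝ → ℂ} (hD : ∀ k x, HasDerivAt (D k) (D (k + 1) x) x)
    {c l : ℝ} (h0 : ∀ x ∈ Set.Ioo (-1 : ℝ) 1, (1 - (x : ℂ) ^ 2) * D 2 x - 2 * x * D 1 x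
      - (c : ℂ) ^ 2 * (x : ℂ) ^ 2 * D 0 x = l * D 0 x) (k : ℕ) :
    (-1) ^ k * D k 1 = ((polyU c k).eval l : ℝ) * D 0 1 := by
  have hcont : ∀ k, Continuous (D k) := fun k =>
    continuous_iff_continuousAt.2 fun x => (hD k x).continuousAt
  have h1 : ∀ k : ℕ, -2 * ((k : ℂ) + 1) * D (k + 1) 1 = (l + (c ^ 2 + k * (k + 1))) * D k 1
      + 2 * c ^ 2 * k * D (k - 1) 1 + c ^ 2 * k * (k - 1) * D (k - 2) 1 := by
    intro k
    have hcl : ∀ x ∈ closure (Set.Ioo (-1 : ℝ) 1), _ = _ :=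
      Set.EqOn.closure (heun_iterated_deriv hD h0 k)
        (by have := hcont (k + 2); have := hcont (k + 1); have := hcont k
            have := hcont (k - 1); have := hcont (k - 2); fun_prop)
        (by have := hcont k; fun_prop)
    have h2 := hcl 1 (by rw [closure_Ioo (by norm_num)]; norm_num)
    simp only [Complex.ofReal_one] at h2
    linear_combination h2
  induction k using Nat.strong_induction_on with
  | _ k ih =>
    match k with
    | 0 => simp [polyU]
    | k + 1 =>
      have hk : (2 : ℂ) * ((k : ℂ) + 1) ≠ 0 :=
        mul_ne_zero two_ne_zero (by exact_mod_cast k.succ_ne_zero)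
      refine mul_left_cancel₀ hk ?_
      have hp := congrArg (fun r : ℝ => (r : ℂ)) (polyU_succ c k l)
      push_cast at hp
      rw [← mul_assoc _ _ (D 0 1), hp]
      have i0 := ih k (by omega)
      have i1 : (k : ℂ) * (-(-1) ^ k * D (k - 1) 1) =
          k * (((polyU c (k - 1)).eval l : ℝ) * D 0 1) := by
        match k with
        | 0 => simp
        | j + 1 =>
          rw [Nat.add_sub_cancel, ← ih j (by omega)]
          ring
      have i2 : (k : ℂ) * (k - 1) * ((-1) ^ k * D (k - 2) 1) =
          k * (k - 1) * (((polyU c (k - 2)).eval l : ℝ) * D 0 1) := by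
        match k with
        | 0 => simp
        | 1 => simp
        | j + 2 =>
          rw [Nat.add_sub_cancel, ← ih j (by omega)]
          ring
      rw [pow_succ]
      linear_combination ((-1) ^ k) * h1 k + (l + (c ^ 2 + k * (k + 1))) * i0
        - 2 * c ^ 2 * i1 + c ^ 2 * i2

/-! ### Compactness, adjoint and injectivity of the finite Fourier transform -/

theorem memLp_of_continuous {φ : ℝ → ℂ} (hφ : Continuous φ) : MemLp φ 2 μI := by
  obtain ⟨C, hC⟩ := isCompact_Icc.exists_bound_of_continuousOn (s := Set.Icc (-1 : ℝ) 1)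
    hφ.continuousOn
  refine MemLp.of_bound hφ.aestronglyMeasurable C ?_
  filter_upwards [ae_restrict_mem measurableSet_Icc] with t ht using hC t ht

/-- The monomial `t ↦ t ^ k` in `L²[-1, 1]`. -/
def monomialL2 (k : ℕ) : L2 :=
  (memLp_of_continuous (φ := fun t : ℝ => (t : ℂ) ^ k) (by fun_prop)).toLp _

theorem monomialL2_ae (k : ℕ) : monomialL2 k =ᵐ[μI] fun t : ℝ => (t : ℂ) ^ k :=
  MemLp.coeFn_toLp _

theorem exists_norm_monomialL2_le : ∃ M : ℝ, 0 ≤ M ∧ ∀ k, ‖monomialL2 k‖ ≤ M := by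
  refine ⟨measureUnivNNReal μI ^ (2 : ENNReal).toReal⁻¹ * 1, by positivity, fun k => ?_⟩
  refine Lp.norm_le_of_ae_bound zero_le_one ?_
  filter_upwards [monomialL2_ae k, ae_abs_le_one] with t h1 h2
  rw [h1, norm_pow, Complex.norm_real]
  exact pow_le_one₀ (norm_nonneg _) h2

theorem inner_monomialL2 (k : ℕ) (f : L2) :
    inner ℂ (monomialL2 k) f = ∫ t : ℝ, (t : ℂ) ^ k * f t ∂μI := by
  rw [L2.inner_def]
  refine integral_congr_ae ?_
  filter_upwards [monomialL2_ae k] with t h1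
  rw [h1, RCLike.inner_apply, map_pow, Complex.conj_ofReal, mul_comm]

theorem fourierDeriv_at_zero (c : ℝ) (f : L2) (k : ℕ) :
    fourierDeriv c f k 0 = (Complex.I * c) ^ k * inner ℂ (monomialL2 k) f := by
  rw [inner_monomialL2, ← integral_const_mul, fourierDeriv, fourierFun]
  refine integral_congr_ae (Filter.Eventually.of_forall fun t => ?_)
  simp only [Complex.ofReal_zero, mul_zero, zero_mul, Complex.exp_zero, one_mul, mul_pow, mul_assoc]

/-- The expansion of the kernel `e^{icxt}` in powers of `xt` writes `F_c` as a series of operators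
of rank one that converges in the operator norm. -/
theorem hasSum_finiteFourier (c : ℝ) :
    HasSum (fun k : ℕ => ((Complex.I * c) ^ k / (k.factorial : ℂ)) •
      InnerProductSpace.rankOne ℂ (monomialL2 k) (monomialL2 k)) (finiteFourier c) := by
  obtain ⟨M, hM0, hM⟩ := exists_norm_monomialL2_le
  have hs : Summable (fun k : ℕ => ((Complex.I * c) ^ k / (k.factorial : ℂ)) •
      InnerProductSpace.rankOne ℂ (monomialL2 k) (monomialL2 k)) := by
    refine Summable.of_norm_bounded ((Real.summable_pow_div_factorial |c|).mul_right (M * M)) ?_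
    intro k
    rw [norm_smul, norm_div, norm_pow, norm_mul, Complex.norm_I, one_mul, Complex.norm_real,
      Real.norm_eq_abs, Complex.norm_natCast, InnerProductSpace.norm_rankOne]
    gcongr <;> exact hM k
  convert hs.hasSum
  -- The series converges in norm, so it remains to identify its sum: applied to `f`, a subsequence of
  -- its partial sums converges almost everywhere, and these are the Taylor polynomials of `F_c f`.
  refine ContinuousLinearMap.ext fun f => Lp.ext ?_
  set S := ∑' k : ℕ, ((Complex.I * c) ^ k / (k.factorial : ℂ)) •
      InnerProductSpace.rankOne ℂ (monomialL2 k) (monomialL2 k) with hS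
  have h1 : HasSum (fun k : ℕ => (((Complex.I * c) ^ k / (k.factorial : ℂ)) *
      inner ℂ (monomialL2 k) f) • monomialL2 k) (S f) := by
    have h := hs.hasSum.mapL (ContinuousLinearMap.apply ℂ L2 f)
    simpa [mul_smul] using h
  obtain ⟨ns, hns, hlim⟩ :=
    (tendstoInMeasure_of_tendsto_Lp h1.tendsto_sum_nat).exists_seq_tendsto_ae
  have hfin : ∀ᵐ x ∂μI, ∀ n : ℕ, (∑ k ∈ Finset.range n, (((Complex.I * c) ^ k /
      (k.factorial : ℂ)) * inner ℂ (monomialL2 k) f) • monomialL2 k : L2) x =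
      ∑ k ∈ Finset.range n, (x : ℂ) ^ k / (k.factorial : ℂ) * fourierDeriv c f k 0 := by
    refine ae_all_iff.2 fun n => ?_
    induction n with
    | zero =>
      simp only [Finset.range_zero, Finset.sum_empty]
      exact Lp.coeFn_zero _ _ _
    | succ n ih =>
      simp only [Finset.sum_range_succ]
      filter_upwards [ih, monomialL2_ae n, Lp.coeFn_add (∑ k ∈ Finset.range n,
        (((Complex.I * c) ^ k / (k.factorial : ℂ)) * inner ℂ (monomialL2 k) f) • monomialL2 k)
        ((((Complex.I * c) ^ n / (n.factorial : ℂ)) * inner ℂ (monomialL2 n) f) • monomialL2 n),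
        Lp.coeFn_smul (((Complex.I * c) ^ n / (n.factorial : ℂ)) * inner ℂ (monomialL2 n) f)
          (monomialL2 n)] with x h1 h2 h3 h4
      rw [h3, Pi.add_apply, h1, h4, Pi.smul_apply, h2, fourierDeriv_at_zero, smul_eq_mul]
      ring
  filter_upwards [finiteFourier_ae c f, hlim, hfin] with x hx hl hf
  rw [hx]
  have h2 := (hasSum_fourierFun_add c (integrable_L2 f) 0 x).tendsto_sum_nat.comp hns.tendsto_atTop
  rw [zero_add] at h2
  refine tendsto_nhds_unique h2 (hl.congr fun i => ?_)
  exact hf (ns i)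

theorem isCompactOperator_finiteFourier (c : ℝ) : IsCompactOperator (finiteFourier c) := by
  refine isCompactOperator_of_tendsto (hasSum_finiteFourier c)
    (Filter.Eventually.of_forall fun s => ?_)
  refine Submodule.sum_mem (compactOperator (RingHom.id ℂ) L2 L2) fun k _ => ?_
  have h : IsCompactOperator (InnerProductSpace.rankOne ℂ (monomialL2 k) (monomialL2 k)) := by
    rw [InnerProductSpace.rankOne_def']
    exact (isCompactOperator_of_locallyCompactSpace_rng
      (ContinuousLinearMap.toSpanSingleton ℂ (monomialL2 k))).comp_clm _
  exact Submodule.smul_mem (compactOperator (RingHom.id ℂ) L2 L2) _ h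

theorem adjoint_finiteFourier (c : ℝ) :
    ContinuousLinearMap.adjoint (finiteFourier c) = finiteFourier (-c) := by
  have h := (hasSum_finiteFourier c).map (ContinuousLinearMap.adjoint (𝕜 := ℂ) (E := L2) (F := L2))
    (ContinuousLinearMap.adjoint (𝕜 := ℂ) (E := L2) (F := L2)).continuous
  refine h.unique (HasSum.congr_fun (hasSum_finiteFourier (-c)) fun k => ?_)
  simp only [Function.comp_apply, map_smulₛₗ, InnerProductSpace.adjoint_rankOne]
  congr 1
  simp

/-- An integrable function on `[-1, 1]` all of whose moments vanish is zero almost everywhere. -/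
theorem ae_eq_zero_of_moments {f : ℝ → ℂ} (hf : Integrable f μI)
    (h : ∀ k : ℕ, ∫ t : ℝ, (t : ℂ) ^ k * f t ∂μI = 0) : f =ᵐ[μI] 0 := by
  have hp : ∀ p : Polynomial ℝ, ∫ t : ℝ, ((p.eval t : ℝ) : ℂ) * f t ∂μI = 0 := by
    intro p
    simp only [Polynomial.eval_eq_sum, Polynomial.sum, Complex.ofReal_sum, Finset.sum_mul]
    rw [integral_finsetSum]
    · refine Finset.sum_eq_zero fun k _ => ?_
      simp only [Complex.ofReal_mul, Complex.ofReal_pow, mul_assoc]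
      rw [integral_const_mul, h k, mul_zero]
    · intro k _
      exact integrable_continuous_mul (by fun_prop) hf
  have hg : ∀ g : ℝ → ℝ, Continuous g → ∫ t : ℝ, (g t : ℂ) * f t ∂μI = 0 := by
    intro g hg
    have hb : ∀ ε > 0, ‖∫ t : ℝ, (g t : ℂ) * f t ∂μI‖ ≤ ε * ∫ t, ‖f t‖ ∂μI := by
      intro ε hε
      obtain ⟨p, hpε⟩ := exists_polynomial_near_of_continuousOn (-1) 1 g hg.continuousOn ε hε
      have hi1 : Integrable (fun t : ℝ => (g t : ℂ) * f t) μI :=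
        integrable_continuous_mul (by fun_prop) hf
      have hi2 : Integrable (fun t : ℝ => ((p.eval t : ℝ) : ℂ) * f t) μI :=
        integrable_continuous_mul (Complex.continuous_ofReal.comp p.continuous) hf
      rw [← sub_zero (∫ t : ℝ, (g t : ℂ) * f t ∂μI), ← hp p, ← integral_sub hi1 hi2,
        ← integral_const_mul]
      refine norm_integral_le_of_norm_le (hf.norm.const_mul ε) ?_
      filter_upwards [ae_restrict_mem measurableSet_Icc] with t ht
      rw [← sub_mul, norm_mul, ← Complex.ofReal_sub, Complex.norm_real, norm_sub_rev]
      exact mul_le_mul_of_nonneg_right (hpε t ht).le (norm_nonneg _)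
    have hlim : Filter.Tendsto (fun ε : ℝ => ε * ∫ t, ‖f t‖ ∂μI) (nhdsWithin 0 (Set.Ioi 0))
        (nhds 0) := by
      have : Filter.Tendsto (fun ε : ℝ => ε * ∫ t, ‖f t‖ ∂μI) (nhds 0)
          (nhds (0 * ∫ t, ‖f t‖ ∂μI)) := (continuous_id.mul continuous_const).tendsto 0
      rw [zero_mul] at this
      exact this.mono_left nhdsWithin_le_nhds
    refine norm_le_zero_iff.1 (ge_of_tendsto hlim ?_)
    filter_upwards [self_mem_nhdsWithin] with ε hε using hb ε hε
  have hF : Integrable ((Set.Icc (-1 : ℝ) 1).indicator f) :=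
    (integrable_indicator_iff measurableSet_Icc).2 hf
  have h0 := ae_eq_zero_of_integral_contDiff_smul_eq_zero hF.locallyIntegrable
    (fun g hgd _ => by
      have h2 : (fun x => g x • (Set.Icc (-1 : ℝ) 1).indicator f x) =
          (Set.Icc (-1 : ℝ) 1).indicator fun x => (g x : ℂ) * f x := by
        funext x
        by_cases hx : x ∈ Set.Icc (-1 : ℝ) 1
        · simp only [Set.indicator_of_mem hx, Complex.real_smul]
        · simp only [Set.indicator_of_notMem hx, smul_zero]
      rw [h2, integral_indicator measurableSet_Icc]
      exact hg g hgd.continuous)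
  refine (ae_restrict_iff' measurableSet_Icc).2 ?_
  filter_upwards [h0] with x hx hm
  rwa [Set.indicator_of_mem hm] at hx

theorem eqOn_Ioo_of_ae_eq {φ ψ : ℝ → ℂ} (hφ : Continuous φ) (hψ : Continuous ψ)
    (h : φ =ᵐ[μI] ψ) : Set.EqOn φ ψ (Set.Ioo (-1 : ℝ) 1) :=
  Measure.eqOn_open_of_ae_eq (ae_restrict_of_ae_restrict_of_subset Set.Ioo_subset_Icc_self h)
    isOpen_Ioo hφ.continuousOn hψ.continuousOn

theorem ae_of_forall_Ioo {p : ℝ → Prop} (h : ∀ x ∈ Set.Ioo (-1 : ℝ) 1, p x) : ∀ᵐ x ∂μI, p x := by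
  rw [μI, ← Measure.restrict_congr_set (Ioo_ae_eq_Icc (μ := volume) (a := (-1 : ℝ)) (b := 1))]
  filter_upwards [ae_restrict_mem measurableSet_Ioo] with x hx using h x hx

/-- If `F_c f` vanishes, then so do its derivatives at `0`, which are the moments of `f` up to
nonzero factors. -/
theorem finiteFourier_injective {c : ℝ} (hc : c ≠ 0) {f : L2} (hf : finiteFourier c f = 0) :
    f = 0 := by
  have h0 : fourierFun c f =ᵐ[μI] fun _ => (0 : ℂ) := by
    have h := finiteFourier_ae c f
    rw [hf] at h
    exact h.symm.trans (Lp.coeFn_zero _ _ _)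
  have h1 : ∀ k, ∀ x ∈ Set.Ioo (-1 : ℝ) 1, fourierDeriv c f k x = 0 := by
    intro k
    induction k with
    | zero =>
      rw [fourierDeriv_zero]
      exact eqOn_Ioo_of_ae_eq (continuous_fourierFun c f) continuous_const h0
    | succ k ih =>
      intro x hx
      have hd := (hasDerivAt_fourierDeriv c (integrable_L2 f) k x).congr_of_eventuallyEq
        (f₁ := fun _ => (0 : ℂ))
        (Filter.eventually_of_mem (isOpen_Ioo.mem_nhds hx) fun y hy => (ih y hy).symm)
      exact hd.unique (hasDerivAt_const x 0)
  refine Lp.ext ((ae_eq_zero_of_moments (integrable_L2 f) fun k => ?_).trans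
    (Lp.coeFn_zero _ _ _).symm)
  have h2 := h1 k 0 (by norm_num)
  rw [fourierDeriv_at_zero, inner_monomialL2] at h2
  refine (mul_eq_zero.1 h2).resolve_left (pow_ne_zero _ (mul_ne_zero Complex.I_ne_zero ?_))
  exact_mod_cast hc

/-! ### A total family of smooth eigenvectors -/

theorem heunExpr_conj (c : ℝ) {φ : ℝ → ℂ} (hφ : ContDiff ℝ (⊤ : ℕ∞) φ) (x : ℝ) :
    heunExpr c (fun t => starRingEnd ℂ (φ t)) x = starRingEnd ℂ (heunExpr c φ x) := by
  have hd : ∀ χ : ℝ → ℂ, Differentiable ℝ χ →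
      deriv (fun t => starRingEnd ℂ (χ t)) = fun t => starRingEnd ℂ (deriv χ t) := by
    intro χ hχ
    funext t
    exact ((Complex.conjCLE.toContinuousLinearMap.hasFDerivAt).comp_hasDerivAt t
      (hχ t).hasDerivAt).deriv
  have h1 := contDiff_infty_iff_deriv.1 hφ
  have h2 := contDiff_infty_iff_deriv.1 h1.2
  simp only [heunExpr, hd φ h1.1, hd _ h2.1, map_sub, map_mul, map_pow, map_one, map_ofNat,
    Complex.conj_ofReal]

theorem isSymmetricGraph_heunGraph (c : ℝ) : IsSymmetricGraph (heunGraph c) := by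
  rintro ⟨u, v⟩ ⟨φ, hφ, h1, h2⟩ ⟨u', v'⟩ ⟨ψ, hψ, h3, h4⟩
  dsimp only at h1 h2 h3 h4 ⊢
  have hφc : ContDiff ℝ (⊤ : ℕ∞) fun t => starRingEnd ℂ (φ t) :=
    Complex.conjCLE.toContinuousLinearMap.contDiff.comp hφ
  have hg := integral_heunExpr_mul c hφc hψ
  rw [L2.inner_def, L2.inner_def]
  refine Eq.trans (integral_congr_ae ?_) (hg.trans (integral_congr_ae ?_))
  · filter_upwards [h2, h3] with x h2 h3
    rw [h2, h3, RCLike.inner_apply, heunExpr_conj c hφ, mul_comm]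
  · filter_upwards [h1, h4] with x h1 h4
    rw [h1, h4, RCLike.inner_apply, mul_comm]

theorem heunExpr_neg (c : ℝ) : heunExpr (-c) = heunExpr c := by
  funext φ x
  simp [heunExpr]

theorem fourierFun_smul (c : ℝ) (a : ℂ) (φ : ℝ → ℂ) :
    fourierFun c (a • φ) = a • fourierFun c φ := by
  funext x
  simp only [fourierFun, Pi.smul_apply, smul_eq_mul, mul_left_comm _ a]
  exact integral_const_mul a _

theorem mem_heunGraph_toLp (c : ℝ) {u : L2} {ψ : ℝ → ℂ} (hψ : ContDiff ℝ (⊤ : ℕ∞) ψ)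
    (hu : u =ᵐ[μI] ψ) :
    (u, (memLp_of_continuous (continuous_heunExpr c hψ)).toLp (heunExpr c ψ)) ∈ heunGraph c :=
  ⟨ψ, hψ, hu, MemLp.coeFn_toLp (memLp_of_continuous (continuous_heunExpr c hψ))⟩

/-- `T` may be computed on any smooth representative, as its graph is single-valued. -/
theorem heunGraph_snd_ae (c : ℝ) {u v : L2} {ψ : ℝ → ℂ} (hψ : ContDiff ℝ (⊤ : ℕ∞) ψ)
    (hu : u =ᵐ[μI] ψ) (h : (u, v) ∈ heunGraph c) : v =ᵐ[μI] heunExpr c ψ := by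
  have h1 := mem_heunGraph_toLp c hψ hu
  rw [← heunCore_graph] at h h1
  rw [LinearPMap.mem_graph_snd_inj _ h h1 rfl]
  exact MemLp.coeFn_toLp _

/-- The self-adjoint compact operator `F_c F_c^*`. -/
def fourierSq (c : ℝ) : L2 →L[ℂ] L2 := finiteFourier c ∘L finiteFourier (-c)

theorem isCompactOperator_fourierSq (c : ℝ) : IsCompactOperator (fourierSq c) :=
  (isCompactOperator_finiteFourier c).comp_clm _

theorem isSymmetric_fourierSq (c : ℝ) : (fourierSq c).IsSymmetric := by
  intro u v
  change inner ℂ (finiteFourier c (finiteFourier (-c) u)) v =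
    inner ℂ u (finiteFourier c (finiteFourier (-c) v))
  have h := adjoint_finiteFourier (-c)
  rw [neg_neg] at h
  rw [← h, ContinuousLinearMap.adjoint_inner_left, ContinuousLinearMap.adjoint_inner_right]

/-- An eigenvector of `F_c F_c^*` for a nonzero eigenvalue lies in the range of `F_c`. -/
theorem ae_eq_of_mem_eigenspace_fourierSq (c : ℝ) {μ : ℂ} (hμ : μ ≠ 0) {f : L2}
    (hf : fourierSq c f = μ • f) : f =ᵐ[μI] fourierFun c (μ⁻¹ • finiteFourier (-c) f : L2) := by
  have h : finiteFourier c (μ⁻¹ • finiteFourier (-c) f) = f := by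
    rw [map_smul]
    change μ⁻¹ • fourierSq c f = f
    rw [hf, smul_smul, inv_mul_cancel₀ hμ, one_smul]
  have h2 := finiteFourier_ae c (μ⁻¹ • finiteFourier (-c) f)
  rwa [h] at h2

/-- `T` leaves the eigenspaces of `F_c F_c^*` for nonzero eigenvalues invariant, since it commutes
with `F_c` and `F_c^*` on smooth functions. -/
theorem exists_mem_heunGraph_fourierSq (c : ℝ) {μ : ℂ} (hμ : μ ≠ 0) {f : L2}
    (hf : fourierSq c f = μ • f) : ∃ v : L2, fourierSq c v = μ • v ∧ (f, v) ∈ heunGraph c := by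
  set φ : L2 := μ⁻¹ • finiteFourier (-c) f with hφ
  have hfψ : f =ᵐ[μI] fourierFun c φ := ae_eq_of_mem_eigenspace_fourierSq c hμ hf
  have hψ : ContDiff ℝ (⊤ : ℕ∞) (fourierFun c φ) := contDiff_fourierFun c (integrable_L2 φ)
  have hv := MemLp.coeFn_toLp (memLp_of_continuous (continuous_heunExpr c hψ))
  have hg := mem_heunGraph_toLp c hψ hfψ
  set v : L2 := (memLp_of_continuous (continuous_heunExpr c hψ)).toLp _
  refine ⟨v, Lp.ext ?_, hg⟩
  have h1 : fourierFun (-c) v = heunExpr c (fourierFun (-c) (fourierFun c φ)) := by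
    funext x
    rw [fourierFun_congr (-c) x hv, ← heunExpr_neg, ← heunExpr_fourierFun_comm (-c) hψ]
  have h2 : ContDiff ℝ (⊤ : ℕ∞) (fourierFun (-c) (fourierFun c φ)) :=
    contDiff_fourierFun _ (integrable_of_continuous hψ.continuous)
  have h3 : fourierFun c (fourierFun (-c) (fourierFun c φ)) = μ • fourierFun c φ := by
    have h4 : fourierFun (-c) (fourierFun c φ) = fourierFun (-c) f :=
      funext fun x => fourierFun_congr _ x hfψ.symm
    have h5 : fourierFun (-c) f =ᵐ[μI] μ • (φ : ℝ → ℂ) := by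
      have h6 := Lp.coeFn_smul μ φ
      rw [hφ, smul_smul, mul_inv_cancel₀ hμ, one_smul, ← hφ] at h6
      exact (finiteFourier_ae (-c) f).symm.trans h6
    rw [h4, ← fourierFun_smul]
    exact funext fun x => fourierFun_congr _ x h5
  calc (fourierSq c v : ℝ → ℂ) =ᵐ[μI] fourierFun c (finiteFourier (-c) v) := finiteFourier_ae c _
    _ = fourierFun c (heunExpr c (fourierFun (-c) (fourierFun c φ))) := by
        funext x
        rw [← h1]
        exact fourierFun_congr _ x (finiteFourier_ae (-c) v)
    _ = heunExpr c (μ • fourierFun c φ) := by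
        funext x
        rw [← h3, heunExpr_fourierFun_comm c h2]
    _ =ᵐ[μI] μ • (v : ℝ → ℂ) := by
        rw [heunExpr_smul]
        exact hv.symm.const_smul μ
    _ =ᵐ[μI] (μ • v : L2) := (Lp.coeFn_smul μ v).symm

/-- `u = F_c φ` almost everywhere on `[-1, 1]` for an integrable `φ`, and the entire function `F_c φ`
solves the eigenvalue equation of the prolate operator for `l` on `(-1, 1)`. The zero vector is
allowed. -/
def IsFourierEigenvector (c l : ℝ) (φ : ℝ → ℂ) (u : L2) : Prop :=
  Integrable φ μI ∧ u =ᵐ[μI] fourierFun c φ ∧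
    ∀ x ∈ Set.Ioo (-1 : ℝ) 1, heunExpr c (fourierFun c φ) x = l * fourierFun c φ x

theorem isFourierEigenvector_of_mem_heunGraph {c l : ℝ} {φ : ℝ → ℂ} {u : L2}
    (hφ : Integrable φ μI) (hu : u =ᵐ[μI] fourierFun c φ) (h : (u, (l : ℂ) • u) ∈ heunGraph c) :
    IsFourierEigenvector c l φ u := by
  have hψ := contDiff_fourierFun c hφ
  refine ⟨hφ, hu, eqOn_Ioo_of_ae_eq (continuous_heunExpr c hψ)
    (continuous_const.mul hψ.continuous) ?_⟩
  refine (heunGraph_snd_ae c hψ hu h).symm.trans ((Lp.coeFn_smul _ u).trans ?_)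
  exact hu.const_smul (l : ℂ)

theorem IsFourierEigenvector.mem_heunGraph {c l : ℝ} {φ : ℝ → ℂ} {u : L2}
    (h : IsFourierEigenvector c l φ u) : (u, (l : ℂ) • u) ∈ heunGraph c := by
  refine ⟨fourierFun c φ, contDiff_fourierFun c h.1, h.2.1, ?_⟩
  refine (Lp.coeFn_smul _ u).trans ((h.2.1.const_smul (l : ℂ)).trans ?_)
  filter_upwards [ae_of_forall_Ioo h.2.2] with x hx
  rw [hx]
  rfl

/-- The finite-dimensional eigenspaces of `F_c F_c^*` for nonzero eigenvalues are spanned by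
eigenvectors of `T`, which is symmetric on them; by the spectral theorem for `F_c F_c^*` these
eigenvectors are total. -/
theorem eq_zero_of_forall_isFourierEigenvector {c : ℝ} (hc : c ≠ 0) {g : L2}
    (h : ∀ l φ u, IsFourierEigenvector c l φ u → inner ℂ g u = 0) : g = 0 := by
  have hbot := ContinuousLinearMap.orthogonalComplement_iSup_eigenspaces_eq_bot
    (isCompactOperator_fourierSq c) (isSymmetric_fourierSq c)
  rw [← Submodule.mem_bot ℂ, ← hbot, Submodule.mem_orthogonal']
  suffices hle : (⨆ μ, Module.End.eigenspace (fourierSq c : Module.End ℂ L2) μ) ≤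
      LinearMap.ker (innerSL ℂ g : L2 →ₗ[ℂ] ℂ) from fun u hu => hle hu
  refine iSup_le fun μ => ?_
  by_cases hμ : μ = 0
  · intro f hf
    rw [hμ, Module.End.mem_eigenspace_iff, zero_smul] at hf
    have h1 : f = 0 := finiteFourier_injective (neg_ne_zero.2 hc) (finiteFourier_injective hc hf)
    rw [h1]
    exact Submodule.zero_mem _
  have hfin := ContinuousLinearMap.finite_dimensional_eigenspace
    (isCompactOperator_fourierSq c) μ hμ
  set E := Module.End.eigenspace (fourierSq c : Module.End ℂ L2) μ with hE
  have hmem : ∀ f : L2, f ∈ E ↔ fourierSq c f = μ • f := fun f => Module.End.mem_eigenspace_iff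
  have hdom : ∀ f : L2, f ∈ E → ∃ hf : f ∈ (heunCore c).domain, heunCore c ⟨f, hf⟩ ∈ E := by
    intro f hf
    obtain ⟨v, hv, hg⟩ := exists_mem_heunGraph_fourierSq c hμ ((hmem f).1 hf)
    rw [← heunCore_graph, LinearPMap.mem_graph_iff] at hg
    obtain ⟨⟨y, hy⟩, rfl, hyv⟩ := hg
    exact ⟨hy, hyv ▸ (hmem v).2 hv⟩
  let A : E →ₗ[ℂ] E :=
    ((heunCore c).toFun ∘ₗ Submodule.inclusion (fun f hf => (hdom f hf).1)).codRestrict E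
      (fun f => (hdom f f.2).2)
  have hAg : ∀ f : E, ((f : L2), (A f : L2)) ∈ heunGraph c := by
    intro f
    rw [← heunCore_graph]
    exact (heunCore c).mem_graph ⟨f, (hdom f f.2).1⟩
  have hA : A.IsSymmetric := fun f f' =>
    isSymmetricGraph_heunGraph c _ (hAg f) _ (hAg f')
  intro f hf
  have hsum := congrArg (fun v : E => (v : L2)) ((hA.eigenvectorBasis rfl).sum_repr ⟨f, hf⟩)
  dsimp only at hsum
  rw [← hsum, LinearMap.mem_ker, AddSubmonoidClass.coe_finsetSum, map_sum]
  refine Finset.sum_eq_zero fun i _ => ?_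
  set b := hA.eigenvectorBasis rfl i with hb
  have hbg := hAg b
  rw [hb, hA.apply_eigenvectorBasis, ← hb] at hbg
  have h2 : (innerSL ℂ g : L2 →ₗ[ℂ] ℂ) b = 0 := h _ _ _
    (isFourierEigenvector_of_mem_heunGraph (integrable_L2 _)
    (ae_eq_of_mem_eigenspace_fourierSq c hμ ((hmem b).1 b.2)) hbg)
  rw [Submodule.coe_smul, map_smul, h2, smul_zero]

theorem orthogonal_eigenspan_heunCore {c : ℝ} (hc : c ≠ 0) : (eigenspan (heunCore c))ᗮ = ⊥ := by
  refine (Submodule.eq_bot_iff _).2 fun g hg => ?_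
  refine eq_zero_of_forall_isFourierEigenvector hc fun l φ u hu => ?_
  refine (Submodule.mem_orthogonal' _ _).1 hg u (Submodule.mem_iSup_of_mem l ?_)
  rw [mem_eigenspace_iff, heunCore_graph]
  exact hu.mem_heunGraph

theorem isClosable_heunCore {c : ℝ} (hc : c ≠ 0) : (heunCore c).IsClosable :=
  isClosable_of_isSymmetricGraph (by rw [heunCore_graph]; exact isSymmetricGraph_heunGraph c)
    (dense_of_orthogonal_eigenspan (orthogonal_eigenspan_heunCore hc))

theorem isClosed_heunOp {c : ℝ} (hc : c ≠ 0) : (heunOp c).IsClosed :=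
  (isClosable_heunCore hc).closure_isClosed

theorem isSymmetricGraph_heunOp {c : ℝ} (hc : c ≠ 0) : IsSymmetricGraph (heunOp c).graph := by
  rw [heunOp, ← (isClosable_heunCore hc).graph_closure_eq_closure_graph, heunCore_graph]
  exact (isSymmetricGraph_heunGraph c).topologicalClosure

theorem orthogonal_eigenspan_heunOp {c : ℝ} (hc : c ≠ 0) : (eigenspan (heunOp c))ᗮ = ⊥ := by
  rw [eq_bot_iff, ← orthogonal_eigenspan_heunCore hc]
  exact Submodule.orthogonal_le (iSup_mono fun l =>
    eigenspace_mono (LinearPMap.le_closure (heunCore c)) l)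

theorem IsFourierEigenvector.mem_eigenspace {c l : ℝ} {φ : ℝ → ℂ} {u : L2}
    (h : IsFourierEigenvector c l φ u) : u ∈ eigenspace (heunOp c) l := by
  refine eigenspace_mono (LinearPMap.le_closure (heunCore c)) l ?_
  rw [mem_eigenspace_iff, heunCore_graph]
  exact h.mem_heunGraph

/-! ### Eigenfunctions and the series `U(ξ; l)` -/

/-- A solution `ψ = F_d φ` of the eigenvalue equation satisfies `ψ(1 - ξ) = ψ(1) U(ξ; l)`. The
parameters `c` and `d` are independent because `F_c` and `F_{-c}` are both needed for the same
equation, which depends only on `c²`. -/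
theorem hasSum_termU_mul_fourierFun {c d l : ℝ} {φ : ℝ → ℂ} (hφ : Integrable φ μI)
    (h : ∀ x ∈ Set.Ioo (-1 : ℝ) 1, heunExpr c (fourierFun d φ) x = l * fourierFun d φ x) (ξ : ℝ) :
    HasSum (fun k => (termU c ξ l k : ℂ) * fourierFun d φ 1) (fourierFun d φ (1 - ξ)) := by
  have hs := hasSum_fourierFun_add d hφ 1 (-ξ)
  rw [← sub_eq_add_neg] at hs
  refine hs.congr_fun fun k => ?_
  have h1 := iterated_deriv_one (hasDerivAt_fourierDeriv d hφ) (c := c) (l := l)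
    (fun x hx => by rw [← heunExpr_fourierFun d c hφ, h x hx, fourierDeriv_zero]) k
  rw [fourierDeriv_zero] at h1
  simp only [termU, Complex.ofReal_neg, Complex.ofReal_div, Complex.ofReal_mul, Complex.ofReal_pow,
    Complex.ofReal_natCast]
  rw [neg_pow (ξ : ℂ)]
  linear_combination (-(ξ : ℂ) ^ k / k.factorial) * h1

theorem IsFourierEigenvector.hasSum {c l : ℝ} {φ : ℝ → ℂ} {u : L2}
    (h : IsFourierEigenvector c l φ u) (ξ : ℝ) :
    HasSum (fun k => (termU c ξ l k : ℂ) * fourierFun c φ 1) (fourierFun c φ (1 - ξ)) :=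
  hasSum_termU_mul_fourierFun h.1 h.2.2 ξ

theorem IsFourierEigenvector.fourierFun_one_ne_zero {c l : ℝ} {φ : ℝ → ℂ} {u : L2}
    (h : IsFourierEigenvector c l φ u) (hu : u ≠ 0) : fourierFun c φ 1 ≠ 0 := by
  intro h1
  refine hu (Lp.ext (h.2.1.trans (Filter.EventuallyEq.trans ?_ (Lp.coeFn_zero _ _ _).symm)))
  refine Filter.Eventually.of_forall fun x => ?_
  have hs := h.hasSum (1 - x)
  simp only [h1, mul_zero, sub_sub_cancel] at hs
  exact hs.unique hasSum_zero

/-- `U(ξ; l) = ψ(1 - ξ) / ψ(1)` for an eigenfunction `ψ`. -/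
theorem IsFourierEigenvector.seriesU_mul {c l : ℝ} {φ : ℝ → ℂ} {u : L2}
    (h : IsFourierEigenvector c l φ u) (hu : u ≠ 0) (ξ : ℝ) :
    (seriesU c ξ l : ℂ) * fourierFun c φ 1 = fourierFun c φ (1 - ξ) := by
  have h1 := h.fourierFun_one_ne_zero hu
  have hs := (h.hasSum ξ).div_const (fourierFun c φ 1)
  simp only [mul_div_cancel_right₀ _ h1] at hs
  have h2 : ((seriesU c ξ l : ℝ) : ℂ) = fourierFun c φ (1 - ξ) / fourierFun c φ 1 := by
    rw [seriesU, Complex.ofReal_tsum]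
    exact hs.tsum_eq
  rw [h2, div_mul_cancel₀ _ h1]

theorem IsFourierEigenvector.fourierFun_eq {c l : ℝ} {φ φ' : ℝ → ℂ} {u u' : L2}
    (h : IsFourierEigenvector c l φ u) (hu : u ≠ 0) (h' : IsFourierEigenvector c l φ' u') :
    fourierFun c φ' = (fourierFun c φ' 1 / fourierFun c φ 1) • fourierFun c φ := by
  funext x
  have h1 := h.fourierFun_one_ne_zero hu
  have hs := h.hasSum (1 - x)
  have hs' := h'.hasSum (1 - x)
  rw [sub_sub_cancel] at hs hs'
  refine hs'.unique ((hs.mul_left (fourierFun c φ' 1 / fourierFun c φ 1)).congr_fun fun k => ?_)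
  field_simp

/-- The eigenfunctions for a given eigenvalue are determined by their value at `1`. -/
theorem IsFourierEigenvector.eq_smul {c l : ℝ} {φ φ' : ℝ → ℂ} {u u' : L2}
    (h : IsFourierEigenvector c l φ u) (hu : u ≠ 0) (h' : IsFourierEigenvector c l φ' u') :
    u' = (fourierFun c φ' 1 / fourierFun c φ 1) • u := by
  refine Lp.ext (h'.2.1.trans (Filter.EventuallyEq.trans ?_ (Lp.coeFn_smul _ u).symm))
  have h1 := h.fourierFun_eq hu h'
  refine Filter.EventuallyEq.trans (Filter.EventuallyEq.of_eq h1) ?_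
  exact (h.2.1.const_smul _).symm

/-- Every eigenvector of the closure is one of the smooth eigenvectors: after subtracting its
component along a smooth eigenvector for the same eigenvalue it is orthogonal to a total set. -/
theorem exists_isFourierEigenvector {c : ℝ} (hc : c ≠ 0) {l : ℝ} {f : L2}
    (hf : f ∈ eigenspace (heunOp c) l) (hf0 : f ≠ 0) : ∃ φ, IsFourierEigenvector c l φ f := by
  have hsym := isSymmetricGraph_heunOp hc
  by_cases hw : ∃ φ w, IsFourierEigenvector c l φ w ∧ w ≠ 0
  · obtain ⟨φ, w, hw, hw0⟩ := hw
    set a : ℂ := inner ℂ w f / inner ℂ w w with ha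
    have hww : inner ℂ w w ≠ 0 := inner_self_ne_zero.2 hw0
    have h0 : f - a • w = 0 := by
      refine eq_zero_of_forall_isFourierEigenvector hc fun m φ' u hu => ?_
      by_cases hml : l = m
      · subst hml
        rw [hw.eq_smul hw0 hu, inner_smul_right]
        have h1 : inner ℂ w (f - a • w) = 0 := by
          rw [inner_sub_right, inner_smul_right, ha, div_mul_cancel₀ _ hww, sub_self]
        rw [inner_eq_zero_symm.1 h1, mul_zero]
      · exact inner_eq_zero_of_mem_eigenspace hsym hml
          (Submodule.sub_mem _ hf (Submodule.smul_mem _ _ hw.mem_eigenspace)) hu.mem_eigenspace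
    have hfa : f = a • w := sub_eq_zero.1 h0
    have hae : f =ᵐ[μI] fourierFun c (a • φ) := by
      rw [hfa, fourierFun_smul]
      exact (Lp.coeFn_smul a w).trans (hw.2.1.const_smul a)
    refine ⟨a • φ, isFourierEigenvector_of_mem_heunGraph (hw.1.smul a) hae ?_⟩
    rw [hfa, smul_comm]
    exact (heunGraph c).smul_mem a hw.mem_heunGraph
  · refine absurd (eq_zero_of_forall_isFourierEigenvector hc fun m φ' u hu => ?_) hf0
    by_cases hml : l = m
    · subst hml
      have : u = 0 := by
        by_contra hu0
        exact hw ⟨φ', u, hu, hu0⟩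
      rw [this, inner_zero_right]
    · exact inner_eq_zero_of_mem_eigenspace hsym hml hf hu.mem_eigenspace

/-- The eigenvalue of `F_c` on an eigenvector of `T` is found by evaluating at `x = 1`. -/
theorem finiteFourier_apply_of_mem_eigenspace {c : ℝ} (hc : c ≠ 0) {l : ℝ} {f : L2}
    (hf : f ∈ eigenspace (heunOp c) l) :
    finiteFourier c f = (∫ ξ in (0 : ℝ)..2,
      Complex.exp (Complex.I * c * (1 - ξ)) * (seriesU c ξ l : ℂ)) • f := by
  by_cases hf0 : f = 0
  · rw [hf0, map_zero, smul_zero]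
  obtain ⟨φ, h⟩ := exists_isFourierEigenvector hc hf hf0
  have h1 := h.fourierFun_one_ne_zero hf0
  have hψ := contDiff_fourierFun c h.1
  have hψi := integrable_of_continuous hψ.continuous
  have h2 : IsFourierEigenvector c l (fourierFun c φ) (finiteFourier c f) := by
    refine ⟨hψi, (finiteFourier_ae c f).trans (Filter.Eventually.of_forall fun x =>
      fourierFun_congr c x h.2.1), fun x _ => ?_⟩
    rw [heunExpr_fourierFun_comm c hψ, fourierFun_congr c x (g := (l : ℂ) • fourierFun c φ)
      (ae_of_forall_Ioo h.2.2), fourierFun_smul]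
    rfl
  rw [h.eq_smul hf0 h2]
  congr 1
  rw [div_eq_iff h1, ← intervalIntegral.integral_mul_const]
  simp only [mul_assoc, h.seriesU_mul hf0]
  have h3 := intervalIntegral.integral_comp_sub_left (a := 0) (b := 2)
    (fun t : ℝ => Complex.exp (Complex.I * c * t) * fourierFun c φ t) 1
  simp only [Complex.ofReal_sub, Complex.ofReal_one, mul_assoc] at h3
  rw [h3, fourierFun, integral_Icc_eq_integral_Ioc,
    ← intervalIntegral.integral_of_le (by norm_num)]
  norm_num [mul_assoc]

/-! ### Bounds for the coefficients `U_k(l) / k!` -/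

/-- The recurrence for `U_k / k!` as an inequality. The truncated indices for `k ≤ 1` are harmless,
as they only add nonnegative terms. -/
theorem abs_polyU_succ_le (c l : ℝ) (k : ℕ) :
    2 * ((k : ℝ) + 1) ^ 2 * |(polyU c (k + 1)).eval l / ((k + 1).factorial : ℝ)| ≤
      (|l| + c ^ 2 + k * (k + 1)) * |(polyU c k).eval l / (k.factorial : ℝ)|
      + 2 * c ^ 2 * |(polyU c (k - 1)).eval l / ((k - 1).factorial : ℝ)|
      + c ^ 2 * |(polyU c (k - 2)).eval l / ((k - 2).factorial : ℝ)| := by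
  have hk1 : (0 : ℝ) < (k : ℝ) + 1 := by positivity
  have hf : (0 : ℝ) < (k.factorial : ℝ) := by positivity
  have e0 : 2 * ((k : ℝ) + 1) ^ 2 * ((polyU c (k + 1)).eval l / ((k + 1).factorial : ℝ)) =
      (l + (c ^ 2 + k * (k + 1))) * ((polyU c k).eval l / (k.factorial : ℝ))
      - 2 * c ^ 2 * (k * (polyU c (k - 1)).eval l / (k.factorial : ℝ))
      + c ^ 2 * (k * (k - 1) * (polyU c (k - 2)).eval l / (k.factorial : ℝ)) := by
    have h := polyU_succ c k l
    rw [Nat.factorial_succ]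
    push_cast
    field_simp
    linear_combination h
  have e1 : |k * (polyU c (k - 1)).eval l / (k.factorial : ℝ)| ≤
      |(polyU c (k - 1)).eval l / ((k - 1).factorial : ℝ)| := by
    match k with
    | 0 => simp
    | j + 1 =>
      refine le_of_eq (congrArg _ ?_)
      rw [Nat.add_sub_cancel, Nat.factorial_succ]
      push_cast
      field_simp
  have e2 : |k * (k - 1) * (polyU c (k - 2)).eval l / (k.factorial : ℝ)| ≤
      |(polyU c (k - 2)).eval l / ((k - 2).factorial : ℝ)| := by
    match k with
    | 0 => simp
    | 1 => simp
    | j + 2 =>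
      refine le_of_eq (congrArg _ ?_)
      rw [Nat.add_sub_cancel, Nat.factorial_succ, Nat.factorial_succ]
      push_cast
      field_simp
      ring
  have e3 : |l + (c ^ 2 + k * (k + 1))| ≤ |l| + c ^ 2 + k * (k + 1) := by
    refine (abs_add_le _ _).trans (le_of_eq ?_)
    rw [abs_of_nonneg (by positivity : 0 ≤ c ^ 2 + (k : ℝ) * (k + 1)), add_assoc]
  calc _ = |2 * ((k : ℝ) + 1) ^ 2 * ((polyU c (k + 1)).eval l / ((k + 1).factorial : ℝ))| := by
        rw [abs_mul, abs_of_pos (by positivity : 0 < 2 * ((k : ℝ) + 1) ^ 2)]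
    _ ≤ _ := by
        rw [e0]
        refine (abs_add_le _ _).trans (add_le_add ((abs_sub _ _).trans (add_le_add ?_ ?_)) ?_)
        · rw [abs_mul]
          exact mul_le_mul_of_nonneg_right e3 (abs_nonneg _)
        · rw [abs_mul, abs_of_nonneg (by positivity)]
          exact mul_le_mul_of_nonneg_left e1 (by positivity)
        · rw [abs_mul, abs_of_nonneg (by positivity)]
          exact mul_le_mul_of_nonneg_left e2 (by positivity)

/-- The radius of convergence of `∑ U_k(l) ξ ^ k / k!` is at least `2`, locally uniformly in `l`:
asymptotically the recurrence multiplies the coefficients by `1 / 2`. -/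
theorem exists_abs_polyU_le (c M : ℝ) {ρ : ℝ} (hρ : 1 / 2 < ρ) :
    ∃ K : ℝ, 0 ≤ K ∧ ∀ l, |l| ≤ M → ∀ k, |(polyU c k).eval l / (k.factorial : ℝ)| ≤ K * ρ ^ k := by
  have hρ0 : 0 < ρ := by linarith
  obtain ⟨n, hn⟩ := exists_nat_ge ((M + 9 * c ^ 2) / (2 * ρ - 1))
  rw [div_le_iff₀ (by linarith)] at hn
  have hb : ∀ k : ℕ, ∃ C : ℝ, ∀ l ∈ Set.Icc (-M) M,
      ‖(polyU c k).eval l / (k.factorial : ℝ) / ρ ^ k‖ ≤ C := fun k =>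
    isCompact_Icc.exists_bound_of_continuousOn
      (((polyU c k).continuous.div_const _).div_const _).continuousOn
  choose C hC using hb
  -- The indices up to `n` are handled by compactness of `[-M, M]`; beyond `n` the recurrence preserves
  -- the bound.
  have hK : 0 ≤ ∑ k ∈ Finset.range (n + 1), |C k| := Finset.sum_nonneg fun _ _ => abs_nonneg _
  refine ⟨∑ k ∈ Finset.range (n + 1), |C k|, hK, fun l hl k => ?_⟩
  have hM : 0 ≤ M := (abs_nonneg l).trans hl
  set K := ∑ k ∈ Finset.range (n + 1), |C k|
  induction k using Nat.strong_induction_on with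
  | _ k ih =>
    by_cases hkn : k ∈ Finset.range (n + 1)
    · have h1 := (hC k l (abs_le.1 hl)).trans ((le_abs_self _).trans
        (Finset.single_le_sum (f := fun k => |C k|) (fun _ _ => abs_nonneg _) hkn))
      rwa [norm_div, Real.norm_eq_abs, norm_pow, Real.norm_eq_abs, abs_of_pos hρ0,
        div_le_iff₀ (by positivity)] at h1
    · obtain ⟨j, rfl⟩ : ∃ j, k = j + 1 := ⟨k - 1, by simp at hkn; omega⟩
      have hjn : n ≤ j := by simp at hkn; omega
      have hj1 : (n : ℝ) ≤ j := by exact_mod_cast hjn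
      have h0 := abs_polyU_succ_le c l j
      have i0 := ih j (by omega)
      have i1 := ih (j - 1) (by omega)
      have i2 := ih (j - 2) (by omega)
      have p1 : ρ ^ (j - 1) ≤ 2 * ρ ^ j := by
        rcases j with _ | j
        · norm_num
        · rw [Nat.add_sub_cancel, pow_succ]
          nlinarith [pow_pos hρ0 j]
      have p2 : ρ ^ (j - 2) ≤ 4 * ρ ^ j := by
        rcases j with _ | _ | j
        · norm_num
        · norm_num
          linarith
        · rw [show j + 1 + 1 - 2 = j by omega, pow_succ, pow_succ]
          have : 1 ≤ 4 * (ρ * ρ) := by nlinarith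
          nlinarith [pow_pos hρ0 j]
      have h1 : 2 * ((j : ℝ) + 1) ^ 2 * |(polyU c (j + 1)).eval l / ((j + 1).factorial : ℝ)| ≤
          (M + 9 * c ^ 2 + j * (j + 1)) * (K * ρ ^ j) := by
        refine h0.trans ?_
        have t0 : (|l| + c ^ 2 + j * (j + 1)) * |(polyU c j).eval l / (j.factorial : ℝ)| ≤
            (M + c ^ 2 + j * (j + 1)) * (K * ρ ^ j) := by gcongr
        have t1 : 2 * c ^ 2 * |(polyU c (j - 1)).eval l / ((j - 1).factorial : ℝ)| ≤
            2 * c ^ 2 * (K * (2 * ρ ^ j)) := by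
          gcongr
          exact i1.trans (mul_le_mul_of_nonneg_left p1 hK)
        have t2 : c ^ 2 * |(polyU c (j - 2)).eval l / ((j - 2).factorial : ℝ)| ≤
            c ^ 2 * (K * (4 * ρ ^ j)) := by
          gcongr
          exact i2.trans (mul_le_mul_of_nonneg_left p2 hK)
        linarith
      have h2 : M + 9 * c ^ 2 + j * (j + 1) ≤ 2 * ((j : ℝ) + 1) ^ 2 * ρ := by
        have hj0 : (0 : ℝ) ≤ j := Nat.cast_nonneg j
        have : (n : ℝ) * (2 * ρ - 1) ≤ ((j : ℝ) + 1) ^ 2 * (2 * ρ - 1) :=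
          mul_le_mul_of_nonneg_right (by nlinarith) (by linarith)
        nlinarith
      have h3 := h1.trans (mul_le_mul_of_nonneg_right h2 (by positivity : 0 ≤ K * ρ ^ j))
      have h4 : 2 * ((j : ℝ) + 1) ^ 2 * ρ * (K * ρ ^ j) =
          2 * ((j : ℝ) + 1) ^ 2 * (K * ρ ^ (j + 1)) := by ring
      rw [h4] at h3
      exact le_of_mul_le_mul_left h3 (by positivity)

theorem abs_termU_le {c l ξ ρ K : ℝ} {k : ℕ}
    (h : |(polyU c k).eval l / (k.factorial : ℝ)| ≤ K * ρ ^ k) :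
    ‖termU c ξ l k‖ ≤ K * (|ξ| * ρ) ^ k := by
  rw [termU, Real.norm_eq_abs, mul_div_assoc, abs_mul, abs_pow]
  calc _ ≤ |ξ| ^ k * (K * ρ ^ k) := by gcongr
    _ = _ := by ring

theorem summable_termU (c : ℝ) {ξ : ℝ} (l : ℝ) (hξ : |ξ| < 2) : Summable (termU c ξ l) := by
  -- This `ρ` satisfies both `1 / 2 < ρ` and `|ξ| * ρ < 1`.
  have hρ : 1 / 2 < 2 / (2 + |ξ|) := by
    rw [div_lt_div_iff₀ two_pos (by positivity)]
    linarith
  obtain ⟨K, -, hK⟩ := exists_abs_polyU_le c |l| hρ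
  refine Summable.of_norm_bounded (g := fun k => K * (|ξ| * (2 / (2 + |ξ|))) ^ k) ?_
    fun k => abs_termU_le (hK l le_rfl k)
  refine (summable_geometric_of_lt_one (by positivity) ?_).mul_left K
  rw [← mul_div_assoc, div_lt_one (by positivity)]
  linarith

theorem exists_abs_seriesU_le (c M : ℝ) :
    ∃ C : ℝ, 0 ≤ C ∧ ∀ l, |l| ≤ M → ∀ ξ ∈ Set.Icc (0 : ℝ) 1, |seriesU c ξ l| ≤ C := by
  obtain ⟨K, hK0, hK⟩ := exists_abs_polyU_le c M (ρ := 3 / 4) (by norm_num)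
  have hg := (hasSum_geometric_of_lt_one (r := (3 / 4 : ℝ)) (by norm_num) (by norm_num)).mul_left K
  refine ⟨K * (1 - 3 / 4)⁻¹, by positivity, fun l hl ξ hξ => ?_⟩
  refine tsum_of_norm_bounded hg fun k => (abs_termU_le (hK l hl k)).trans ?_
  have h1 : |ξ| ≤ 1 := abs_le.2 ⟨by linarith [hξ.1], hξ.2⟩
  gcongr
  linarith

/-! ### Uniform boundedness of the normalized eigenfunctions -/

/-- `w`, with derivatives `w₁` and `w₂`, is a real solution of the eigenvalue equation on `(-1, 1)`
that is regular at `x = 1`, normalized by `w(1) = 1`. -/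
structure IsRegularSolution (c l : ℝ) (w w₁ w₂ : ℝ → ℝ) : Prop where
  hasDerivAt : ∀ x, HasDerivAt w (w₁ x) x
  hasDerivAt₁ : ∀ x, HasDerivAt w₁ (w₂ x) x
  eqn : ∀ x ∈ Set.Ioo (-1 : ℝ) 1,
    (1 - x ^ 2) * w₂ x - 2 * x * w₁ x - c ^ 2 * x ^ 2 * w x = l * w x
  map_one : w 1 = 1

theorem IsFourierEigenvector.exists_isRegularSolution {c l : ℝ} {φ : ℝ → ℂ} {u : L2}
    (h : IsFourierEigenvector c l φ u) (hu : u ≠ 0) :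
    ∃ w w₁ w₂, IsRegularSolution c l w w₁ w₂ ∧ ∀ ξ, seriesU c ξ l = w (1 - ξ) := by
  have h1 := h.fourierFun_one_ne_zero hu
  have hd : ∀ k x, HasDerivAt (fun x => (fourierDeriv c φ k x / fourierFun c φ 1).re)
      ((fourierDeriv c φ (k + 1) x / fourierFun c φ 1).re) x := fun k x =>
    (Complex.reCLM.hasFDerivAt).comp_hasDerivAt x
      ((hasDerivAt_fourierDeriv c h.1 k x).div_const (fourierFun c φ 1))
  refine ⟨_, _, _, ⟨hd 0, hd 1, fun x hx => ?_, ?_⟩, fun ξ => ?_⟩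
  · have h2 := h.2.2 x hx
    rw [heunExpr_fourierFun c c h.1, ← fourierDeriv_zero] at h2
    have h3 : ((1 - x ^ 2 : ℝ) : ℂ) * (fourierDeriv c φ 2 x / fourierFun c φ 1)
        - ((2 * x : ℝ) : ℂ) * (fourierDeriv c φ 1 x / fourierFun c φ 1)
        - ((c ^ 2 * x ^ 2 : ℝ) : ℂ) * (fourierDeriv c φ 0 x / fourierFun c φ 1)
        = (l : ℂ) * (fourierDeriv c φ 0 x / fourierFun c φ 1) := by
      push_cast
      linear_combination h2 / fourierFun c φ 1
    have h4 := congrArg Complex.re h3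
    simpa only [Complex.sub_re, Complex.re_ofReal_mul] using h4
  · rw [fourierDeriv_zero, div_self h1, Complex.one_re]
  · rw [fourierDeriv_zero, ← h.seriesU_mul hu, mul_div_cancel_right₀ _ h1, Complex.ofReal_re]

/-- The eigenvalues of `T` are nonpositive: for `l > 0` the function `(1 - x²) w' w`, which vanishes
at both endpoints, would be increasing. -/
theorem IsRegularSolution.nonpos {c l : ℝ} {w w₁ w₂ : ℝ → ℝ} (h : IsRegularSolution c l w w₁ w₂) :
    l ≤ 0 := by
  by_contra! hl
  have hw : Continuous w := continuous_iff_continuousAt.2 fun x => (h.hasDerivAt x).continuousAt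
  have hd : ∀ x ∈ Set.Ioo (-1 : ℝ) 1, HasDerivAt (fun x => (1 - x ^ 2) * (w₁ x * w x))
      ((l + c ^ 2 * x ^ 2) * w x ^ 2 + (1 - x ^ 2) * w₁ x ^ 2) x := by
    intro x hx
    have h1 : HasDerivAt (fun x : ℝ => 1 - x ^ 2) (-(2 * x)) x := by
      simpa using ((hasDerivAt_id x).fun_pow 2).const_sub 1
    refine (h1.mul ((h.hasDerivAt₁ x).mul (h.hasDerivAt x))).congr_deriv ?_
    simp only [Pi.mul_apply]
    linear_combination w x * h.eqn x hx
  have hc : Continuous fun x => (1 - x ^ 2) * (w₁ x * w x) := by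
    have : Continuous w₁ := continuous_iff_continuousAt.2 fun x => (h.hasDerivAt₁ x).continuousAt
    fun_prop
  have hmono : MonotoneOn (fun x => (1 - x ^ 2) * (w₁ x * w x)) (Set.Icc (-1) 1) := by
    refine monotoneOn_of_deriv_nonneg (convex_Icc _ _) hc.continuousOn ?_ ?_ <;>
      rw [interior_Icc]
    · exact fun x hx => (hd x hx).differentiableAt.differentiableWithinAt
    · intro x hx
      rw [(hd x hx).deriv]
      have : 0 ≤ 1 - x ^ 2 := by nlinarith [hx.1, hx.2]
      positivity
  have hz : ∀ x ∈ Set.Ioo (-1 : ℝ) 1, (1 - x ^ 2) * (w₁ x * w x) = 0 := by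
    intro x hx
    have h1 := hmono ⟨le_rfl, by norm_num⟩ ⟨hx.1.le, hx.2.le⟩ hx.1.le
    have h2 := hmono ⟨hx.1.le, hx.2.le⟩ ⟨by norm_num, le_rfl⟩ hx.2.le
    norm_num at h1 h2
    exact le_antisymm h2 h1
  have hw0 : Set.EqOn w (fun _ => 0) (Set.Ioo (-1 : ℝ) 1) := by
    intro x hx
    have h1 := ((hd x hx).congr_of_eventuallyEq (f₁ := fun _ => (0 : ℝ))
      (Filter.eventually_of_mem (isOpen_Ioo.mem_nhds hx) fun y hy => (hz y hy).symm)).unique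
      (hasDerivAt_const x 0)
    have h2 : 0 ≤ (1 - x ^ 2) * w₁ x ^ 2 :=
      mul_nonneg (by nlinarith [hx.1, hx.2]) (sq_nonneg _)
    have h3 : 0 ≤ c ^ 2 * x ^ 2 * w x ^ 2 := by positivity
    have h4 : l * w x ^ 2 = 0 := by nlinarith [mul_nonneg hl.le (sq_nonneg (w x))]
    exact pow_eq_zero_iff two_ne_zero |>.1 ((mul_eq_zero.1 h4).resolve_left hl.ne')
  have h1 := hw0.closure hw continuous_const (x := 1)
    (by rw [closure_Ioo (by norm_num)]; norm_num)
  rw [h.map_one] at h1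
  exact one_ne_zero h1

/-- For `l < -c²` put `p = 1 - x²` and `q = -l - c² x²`. The energy `w² + p w'² / q` is nondecreasing
on `[0, 1]`, because `p q` is nonincreasing there, and equals `1` at `x = 1`. -/
theorem IsRegularSolution.abs_le_one {c l : ℝ} {w w₁ w₂ : ℝ → ℝ}
    (h : IsRegularSolution c l w w₁ w₂) (hl : l < -c ^ 2) {x : ℝ} (hx : x ∈ Set.Icc (0 : ℝ) 1) :
    |w x| ≤ 1 := by
  have hq : ∀ x ∈ Set.Icc (0 : ℝ) 1, 0 < -l - c ^ 2 * x ^ 2 := by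
    intro x hx
    have : x ^ 2 ≤ 1 := pow_le_one₀ hx.1 hx.2
    nlinarith [sq_nonneg c]
  have hsub : ∀ x ∈ Set.Ioo (0 : ℝ) 1, x ∈ Set.Ioo (-1 : ℝ) 1 :=
    fun x hx => ⟨by linarith [hx.1], hx.2⟩
  have hd : ∀ x ∈ Set.Ioo (0 : ℝ) 1,
      HasDerivAt (fun x => w x ^ 2 + (1 - x ^ 2) * w₁ x ^ 2 / (-l - c ^ 2 * x ^ 2))
      ((2 * x * (-l - c ^ 2 * x ^ 2) + 2 * c ^ 2 * x * (1 - x ^ 2)) * w₁ x ^ 2 /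
        (-l - c ^ 2 * x ^ 2) ^ 2) x := by
    intro x hx
    have hqx := hq x ⟨hx.1.le, hx.2.le⟩
    have h1 : HasDerivAt (fun x : ℝ => 1 - x ^ 2) (-(2 * x)) x := by
      simpa using ((hasDerivAt_id x).fun_pow 2).const_sub 1
    have h2 : HasDerivAt (fun x : ℝ => -l - c ^ 2 * x ^ 2) (-(c ^ 2 * (2 * x))) x := by
      simpa using (((hasDerivAt_id x).fun_pow 2).const_mul (c ^ 2)).const_sub (-l)
    refine (((h.hasDerivAt x).fun_pow 2).add
      ((h1.mul ((h.hasDerivAt₁ x).fun_pow 2)).div h2 hqx.ne')).congr_deriv ?_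
    have he := h.eqn x (hsub x hx)
    have hq2 : (-l - c ^ 2 * x ^ 2) ^ 2 ≠ 0 := pow_ne_zero 2 hqx.ne'
    simp only [Pi.mul_apply, Nat.cast_ofNat, Nat.reduceSub, pow_one]
    rw [eq_div_iff hq2, add_mul, div_mul_cancel₀ _ hq2]
    linear_combination (2 * w₁ x * (-l - c ^ 2 * x ^ 2)) * he
  have hw : Continuous w := continuous_iff_continuousAt.2 fun x => (h.hasDerivAt x).continuousAt
  have hw₁ : Continuous w₁ := continuous_iff_continuousAt.2 fun x => (h.hasDerivAt₁ x).continuousAt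
  have hmono : MonotoneOn (fun x => w x ^ 2 + (1 - x ^ 2) * w₁ x ^ 2 / (-l - c ^ 2 * x ^ 2))
      (Set.Icc 0 1) := by
    refine monotoneOn_of_deriv_nonneg (convex_Icc _ _) ?_ ?_ ?_
    · refine (hw.pow 2).continuousOn.add (ContinuousOn.div (by fun_prop) (by fun_prop) ?_)
      exact fun x hx => (hq x hx).ne'
    · rw [interior_Icc]
      exact fun x hx => (hd x hx).differentiableAt.differentiableWithinAt
    · rw [interior_Icc]
      intro x hx
      rw [(hd x hx).deriv]
      have h1 := hq x ⟨hx.1.le, hx.2.le⟩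
      have h2 : 0 ≤ 1 - x ^ 2 := by nlinarith [hx.1, hx.2]
      have h3 := hx.1
      positivity
  have h1 := hmono hx ⟨zero_le_one, le_rfl⟩ hx.2
  simp only [h.map_one, one_pow, sub_self, zero_mul, zero_div, add_zero] at h1
  have h2 : 0 ≤ (1 - x ^ 2) * w₁ x ^ 2 / (-l - c ^ 2 * x ^ 2) := by
    have h3 := hq x hx
    have h4 : 0 ≤ 1 - x ^ 2 := by nlinarith [hx.1, hx.2]
    positivity
  exact (sq_le_one_iff_abs_le_one _).1 (by linarith)

theorem fourierDeriv_neg (c : ℝ) (φ : ℝ → ℂ) (k : ℕ) (x : ℝ) :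
    fourierDeriv (-c) φ k x = (-1) ^ k * fourierDeriv c φ k (-x) := by
  rw [fourierDeriv, fourierDeriv, fourierFun, fourierFun, ← integral_const_mul]
  refine integral_congr_ae (Filter.Eventually.of_forall fun t => ?_)
  have h1 : Complex.I * ((-c : ℝ) : ℂ) * x * t = Complex.I * c * ((-x : ℝ) : ℂ) * t := by
    push_cast
    ring
  have h2 : Complex.I * ((-c : ℝ) : ℂ) * t = -1 * (Complex.I * c * t) := by
    push_cast
    ring
  simp only [h1, h2, mul_pow]
  ring

/-- Eigenfunctions are even or odd, as the reflected eigenfunction is a multiple of the original one;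
so `|U(ξ; l)|` is symmetric about `ξ = 1`. -/
theorem IsFourierEigenvector.abs_seriesU_two_sub {c l : ℝ} {φ : ℝ → ℂ} {u : L2}
    (h : IsFourierEigenvector c l φ u) (hu : u ≠ 0) (ξ : ℝ) :
    |seriesU c (2 - ξ) l| = |seriesU c ξ l| := by
  have h1 := h.fourierFun_one_ne_zero hu
  have hneg : ∀ x, fourierFun (-c) φ x = fourierFun c φ (-x) := by
    intro x
    rw [← fourierDeriv_zero, fourierDeriv_neg, pow_zero, one_mul, fourierDeriv_zero]
  have hs : ∀ ξ : ℝ, fourierFun c φ (-(1 - ξ)) = seriesU c ξ l * fourierFun c φ (-1) := by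
    intro ξ
    have hs := hasSum_termU_mul_fourierFun (c := c) (d := -c) (l := l) h.1 (fun x hx => by
      have h2 := h.2.2 (-x) ⟨by linarith [hx.2], by linarith [hx.1]⟩
      rw [heunExpr_fourierFun c c h.1] at h2
      rw [heunExpr_fourierFun (-c) c h.1, fourierDeriv_neg, fourierDeriv_neg, fourierDeriv_neg,
        hneg, ← h2]
      push_cast
      ring) ξ
    rw [hneg, hneg] at hs
    rw [← hs.tsum_eq, tsum_mul_right, seriesU, Complex.ofReal_tsum]
  -- With `r = ψ(-1) / ψ(1)` one has `ψ(-x) = r ψ(x)`, and `x = -1` gives `r² = 1`.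
  have hsq : ‖fourierFun c φ (-1)‖ = ‖fourierFun c φ 1‖ := by
    have e1 := hs 2
    have e2 := h.seriesU_mul hu 2
    norm_num at e1 e2
    have e3 : fourierFun c φ (-1) ^ 2 = fourierFun c φ 1 ^ 2 := by
      linear_combination (-fourierFun c φ (-1)) * e2 - fourierFun c φ 1 * e1
    have e4 := congrArg norm e3
    rw [norm_pow, norm_pow] at e4
    exact (pow_left_inj₀ (norm_nonneg _) (norm_nonneg _) two_ne_zero).1 e4
  have e1 := h.seriesU_mul hu (2 - ξ)
  rw [show (1 : ℝ) - (2 - ξ) = -(1 - ξ) by ring, hs ξ] at e1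
  have e2 := congrArg norm e1
  rw [norm_mul, norm_mul, hsq, Complex.norm_real, Complex.norm_real] at e2
  exact mul_right_cancel₀ (norm_ne_zero_iff.2 h1) e2

theorem exists_isRegularSolution_of_eigenspace_ne_bot {c : ℝ} (hc : c ≠ 0) {l : ℝ}
    (hl : eigenspace (heunOp c) l ≠ ⊥) :
    ∃ w w₁ w₂, IsRegularSolution c l w w₁ w₂ ∧ ∀ ξ, seriesU c ξ l = w (1 - ξ) := by
  obtain ⟨f, hf, hf0⟩ := Submodule.exists_mem_ne_zero_of_ne_bot hl
  obtain ⟨φ, h⟩ := exists_isFourierEigenvector hc hf hf0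
  exact h.exists_isRegularSolution hf0

theorem continuous_seriesU_of_eigenspace_ne_bot {c : ℝ} (hc : c ≠ 0) {l : ℝ}
    (hl : eigenspace (heunOp c) l ≠ ⊥) : Continuous fun ξ => seriesU c ξ l := by
  obtain ⟨w, w₁, w₂, h, hw⟩ := exists_isRegularSolution_of_eigenspace_ne_bot hc hl
  have hcw : Continuous w := continuous_iff_continuousAt.2 fun x => (h.hasDerivAt x).continuousAt
  simp only [hw]
  fun_prop

/-- `U(ξ; l)` is bounded uniformly in `ξ ∈ [0, 2]` and the eigenvalues `l`. The symmetry about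
`ξ = 1` reduces this to `ξ ∈ [0, 1]`, where the power series serves for `-c² ≤ l ≤ 0` and the energy
estimate for `l < -c²`. -/
theorem exists_abs_seriesU_le_of_eigenspace_ne_bot {c : ℝ} (hc : c ≠ 0) :
    ∃ C : ℝ, 0 ≤ C ∧ ∀ l, eigenspace (heunOp c) l ≠ ⊥ → ∀ ξ ∈ Set.Icc (0 : ℝ) 2,
      |seriesU c ξ l| ≤ C := by
  obtain ⟨C, hC0, hC⟩ := exists_abs_seriesU_le c (c ^ 2)
  refine ⟨max C 1, le_max_of_le_left hC0, fun l hl => ?_⟩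
  have h1 : ∀ ξ ∈ Set.Icc (0 : ℝ) 1, |seriesU c ξ l| ≤ max C 1 := by
    intro ξ hξ
    obtain ⟨w, w₁, w₂, h, hw⟩ := exists_isRegularSolution_of_eigenspace_ne_bot hc hl
    by_cases hlc : l < -c ^ 2
    · rw [hw]
      exact le_max_of_le_right (h.abs_le_one hlc ⟨by linarith [hξ.2], by linarith [hξ.1]⟩)
    · refine le_max_of_le_left (hC l (abs_le.2 ⟨not_lt.1 hlc, ?_⟩) ξ hξ)
      exact h.nonpos.trans (sq_nonneg c)
  intro ξ hξ
  by_cases hξ1 : ξ ≤ 1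
  · exact h1 ξ ⟨hξ.1, hξ1⟩
  · obtain ⟨f, hf, hf0⟩ := Submodule.exists_mem_ne_zero_of_ne_bot hl
    obtain ⟨φ, h⟩ := exists_isFourierEigenvector hc hf hf0
    rw [← h.abs_seriesU_two_sub hf0]
    exact h1 _ ⟨by linarith [hξ.2], by linarith⟩

/-! ### The integral representation -/

/-- The identity `B f = ∫ h(ξ) V(ξ) f dξ` for a bounded family `V(ξ)` passes from a dense set of
vectors `f` to all `f`, together with the integrability. -/
theorem intervalIntegral_apply_of_dense {H : Type*} [NormedAddCommGroup H] [NormedSpace ℂ H]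
    [CompleteSpace H] {B : H →L[ℂ] H} {V : ℝ → H →L[ℂ] H} {h : ℝ → ℂ} {C a b : ℝ}
    (hab : a ≤ b) (hh : ∀ ξ, ‖h ξ‖ = 1)
    (hV : ∀ ξ ∈ Set.Icc a b, ∀ f, ‖V ξ f‖ ≤ C * ‖f‖) {s : Set H} (hs : Dense s)
    (hsV : ∀ f ∈ s, IntervalIntegrable (fun ξ => h ξ • V ξ f) volume a b ∧
      B f = ∫ ξ in a..b, h ξ • V ξ f) (f : H) :
    IntervalIntegrable (fun ξ => h ξ • V ξ f) volume a b ∧ B f = ∫ ξ in a..b, h ξ • V ξ f := by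
  have hC : ∀ ξ ∈ Set.uIoc a b, ∀ f, ‖h ξ • V ξ f‖ ≤ C * ‖f‖ := by
    intro ξ hξ f
    rw [Set.uIoc_of_le hab] at hξ
    rw [norm_smul, hh, one_mul]
    exact hV ξ ⟨hξ.1.le, hξ.2⟩ f
  obtain ⟨u, hu, hlim⟩ := mem_closure_iff_seq_limit.1 (hs f)
  have hpt : ∀ ξ, Filter.Tendsto (fun n => h ξ • V ξ (u n)) Filter.atTop
      (nhds (h ξ • V ξ f)) := fun ξ =>
    (((V ξ).continuous.tendsto f).comp hlim).const_smul (h ξ)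
  have hmeas : AEStronglyMeasurable (fun ξ => h ξ • V ξ f) (volume.restrict (Set.uIoc a b)) :=
    aestronglyMeasurable_of_tendsto_ae Filter.atTop
      (fun n => (intervalIntegrable_iff.1 (hsV (u n) (hu n)).1).aestronglyMeasurable)
      (Filter.Eventually.of_forall hpt)
  have hint : IntervalIntegrable (fun ξ => h ξ • V ξ f) volume a b := by
    rw [intervalIntegrable_iff]
    have : IsFiniteMeasure (volume.restrict (Set.uIoc a b)) := by
      rw [Set.uIoc_of_le hab]
      infer_instance
    refine Integrable.of_bound hmeas (C * ‖f‖) ?_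
    filter_upwards [ae_restrict_mem measurableSet_uIoc] with ξ hξ using hC ξ hξ f
  refine ⟨hint, ?_⟩
  have hdiff : ∀ n, ‖B (u n) - ∫ ξ in a..b, h ξ • V ξ f‖ ≤ C * ‖u n - f‖ * |b - a| := by
    intro n
    rw [(hsV (u n) (hu n)).2, ← intervalIntegral.integral_sub (hsV (u n) (hu n)).1 hint]
    refine intervalIntegral.norm_integral_le_of_norm_le_const fun ξ hξ => ?_
    rw [← smul_sub, ← map_sub]
    exact hC ξ hξ _
  have h0 : Filter.Tendsto (fun n => C * ‖u n - f‖ * |b - a|) Filter.atTop (nhds 0) := by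
    have h1 := ((tendsto_iff_norm_sub_tendsto_zero.1 hlim).const_mul C).mul_const |b - a|
    simpa using h1
  have h1 : Filter.Tendsto (fun n => B (u n)) Filter.atTop
      (nhds (∫ ξ in a..b, h ξ • V ξ f)) :=
    tendsto_iff_norm_sub_tendsto_zero.2 (squeeze_zero (fun _ => norm_nonneg _) hdiff h0)
  exact tendsto_nhds_unique ((B.continuous.tendsto f).comp hlim) h1

theorem finiteFourier_eq_integral_of_mem_eigenspan {c : ℝ} (hc : c ≠ 0) {V : ℝ → (L2 →L[ℂ] L2)}
    (hV : ∀ ξ ∈ Set.Icc (0 : ℝ) 2,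
      IsFunctionOf (heunOp c) (fun l => (seriesU c ξ l : ℂ)) (V ξ)) {f : L2}
    (hf : f ∈ eigenspan (heunOp c)) :
    IntervalIntegrable (fun ξ : ℝ => Complex.exp (Complex.I * c * (1 - ξ)) • V ξ f) volume 0 2 ∧
      finiteFourier c f = ∫ ξ in (0 : ℝ)..2, Complex.exp (Complex.I * c * (1 - ξ)) • V ξ f := by
  refine Submodule.iSup_induction _ (motive := fun f =>
    IntervalIntegrable (fun ξ : ℝ => Complex.exp (Complex.I * c * (1 - ξ)) • V ξ f) volume 0 2 ∧
      finiteFourier c f = ∫ ξ in (0 : ℝ)..2, Complex.exp (Complex.I * c * (1 - ξ)) • V ξ f)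
    hf (fun l f hf => ?_) ?_ fun f g hf hg => ?_
  · by_cases hl : eigenspace (heunOp c) l = ⊥
    · rw [hl, Submodule.mem_bot] at hf
      simp [hf]
    have hcont : Continuous fun ξ : ℝ =>
        (Complex.exp (Complex.I * c * (1 - ξ)) * (seriesU c ξ l : ℂ)) • f := by
      have := continuous_seriesU_of_eigenspace_ne_bot hc hl
      fun_prop
    have heq : Set.EqOn (fun ξ : ℝ => (Complex.exp (Complex.I * c * (1 - ξ)) *
        (seriesU c ξ l : ℂ)) • f) (fun ξ : ℝ => Complex.exp (Complex.I * c * (1 - ξ)) • V ξ f)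
        (Set.uIcc 0 2) := by
      intro ξ hξ
      rw [Set.uIcc_of_le zero_le_two] at hξ
      dsimp only
      rw [(hV ξ hξ).apply_of_mem_eigenspace (isSymmetricGraph_heunOp hc) (isClosed_heunOp hc) hf,
        smul_smul]
    refine ⟨(hcont.intervalIntegrable 0 2).congr (heq.mono Set.uIoc_subset_uIcc), ?_⟩
    rw [finiteFourier_apply_of_mem_eigenspace hc hf, ← intervalIntegral.integral_congr heq,
      intervalIntegral.integral_smul_const]
  · simp
  · simp only [map_add, smul_add]
    refine ⟨hf.1.add hg.1, ?_⟩
    rw [intervalIntegral.integral_add hf.1 hg.1, hf.2, hg.2]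

/-- On an eigenvector for `l` this is the convergent series `U(ξ; l) = ∑ ξ^k U_k(l) / k!`. -/
theorem hasSum_polyApply_of_mem_eigenspan {c ξ : ℝ} (hc : c ≠ 0) (hξ : |ξ| < 2)
    {V : L2 →L[ℂ] L2} (hV : IsFunctionOf (heunOp c) (fun l => (seriesU c ξ l : ℂ)) V) {f : L2}
    (hf : f ∈ eigenspan (heunOp c)) :
    HasSum (fun k : ℕ => ((ξ ^ k / (k.factorial : ℝ) : ℝ) : ℂ) •
      polyApply (heunOp c) (polyU c k) f) (V f) := by
  have key : ∀ l, ∀ f ∈ eigenspace (heunOp c) l,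
      HasSum (fun k : ℕ => ((ξ ^ k / (k.factorial : ℝ) : ℝ) : ℂ) •
        polyApply (heunOp c) (polyU c k) f) (V f) := by
    intro l f hf
    rw [hV.apply_of_mem_eigenspace (isSymmetricGraph_heunOp hc) (isClosed_heunOp hc) hf]
    have h1 : HasSum (fun k => (termU c ξ l k : ℂ)) (seriesU c ξ l : ℂ) :=
      Complex.hasSum_ofReal.2 (summable_termU c l hξ).hasSum
    refine (h1.smul_const f).congr_fun fun k => ?_
    rw [polyApply_of_mem_eigenspace _ hf, smul_smul, termU, ← Complex.ofReal_mul,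
      div_mul_eq_mul_div]
  refine (Submodule.iSup_induction _ (motive := fun f => f ∈ eigenspan (heunOp c) ∧
    HasSum (fun k : ℕ => ((ξ ^ k / (k.factorial : ℝ) : ℝ) : ℂ) •
      polyApply (heunOp c) (polyU c k) f) (V f)) hf
    (fun l f hf => ⟨Submodule.mem_iSup_of_mem l hf, key l f hf⟩)
    ⟨Submodule.zero_mem _, key 0 0 (Submodule.zero_mem _)⟩
    fun f g hf hg => ⟨add_mem hf.1 hg.1, ?_⟩).2
  rw [map_add]
  refine (hf.2.add hg.2).congr_fun fun k => ?_
  rw [polyApply_add _ hf.1 hg.1, smul_add]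

end Prolate
end

theorem mainTheorem1 (c : ℝ) (hc : 0 < c) :
    IsSelfAdjoint (Prolate.heunOp c) ∧
    Prolate.HasCompleteEigenvectors (Prolate.heunOp c) ∧
    (∀ ξ l : ℝ, |ξ| < 2 → Summable (Prolate.termU c ξ l)) ∧
    (∃ V : ℝ → (Prolate.L2 →L[ℂ] Prolate.L2),
      (∀ ξ ∈ Set.Ico (0 : ℝ) 2,
        Prolate.IsFunctionOf (Prolate.heunOp c) (fun l => (Prolate.seriesU c ξ l : ℂ)) (V ξ)) ∧
      (∀ ξ ∈ Set.Ico (0 : ℝ) 2, ∀ f ∈ Prolate.eigenspan (Prolate.heunOp c),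
        HasSum (fun k : ℕ => ((ξ ^ k / (k.factorial : ℝ) : ℝ) : ℂ) •
          Prolate.polyApply (Prolate.heunOp c) (Prolate.polyU c k) f) (V ξ f)) ∧
      (∀ f : Prolate.L2,
        IntervalIntegrable (fun ξ : ℝ => Complex.exp (Complex.I * c * (1 - ξ)) • V ξ f)
          volume 0 2 ∧
        Prolate.finiteFourier c f =
          ∫ ξ in (0 : ℝ)..2, Complex.exp (Complex.I * c * (1 - ξ)) • V ξ f)) ∧
    Prolate.IsFunctionOf (Prolate.heunOp c)
      (fun l => ∫ ξ in (0 : ℝ)..2,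
        Complex.exp (Complex.I * c * (1 - ξ)) * (Prolate.seriesU c ξ l : ℂ))
      (Prolate.finiteFourier c) := by
  have hsym := Prolate.isSymmetricGraph_heunOp hc.ne'
  have hclosed := Prolate.isClosed_heunOp hc.ne'
  have htotal := Prolate.orthogonal_eigenspan_heunOp hc.ne'
  have hcomp := Prolate.hasCompleteEigenvectors_of_isSymmetricGraph hsym hclosed htotal
  refine ⟨Prolate.isSelfAdjoint_of_isSymmetricGraph hsym hclosed htotal, hcomp,
    fun ξ l hξ => Prolate.summable_termU c l hξ, ?_,
    Prolate.isFunctionOf_of_forall_mem_eigenspace hclosed hcomp fun l f hf =>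
      Prolate.finiteFourier_apply_of_mem_eigenspace hc.ne' hf⟩
  obtain ⟨C, hC0, hC⟩ := Prolate.exists_abs_seriesU_le_of_eigenspace_ne_bot hc.ne'
  -- The bound on `U(ξ; l)` for eigenvalues `l` includes the endpoint `ξ = 2`, so that `V` can be
  -- chosen on the closed interval `[0, 2]`.
  have hex : ∀ ξ : ℝ, ∃ B : Prolate.L2 →L[ℂ] Prolate.L2, ξ ∈ Set.Icc (0 : ℝ) 2 →
      Prolate.IsFunctionOf (Prolate.heunOp c) (fun l => (Prolate.seriesU c ξ l : ℂ)) B ∧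
        ∀ f, ‖B f‖ ≤ C * ‖f‖ := by
    intro ξ
    by_cases hξ : ξ ∈ Set.Icc (0 : ℝ) 2
    · obtain ⟨B, hB⟩ := Prolate.exists_isFunctionOf hsym hclosed htotal hC0
        (g := fun l => (Prolate.seriesU c ξ l : ℂ)) fun l hl => by
          rw [Complex.norm_real]
          exact hC l hl ξ hξ
      exact ⟨B, fun _ => hB⟩
    · exact ⟨0, fun h => absurd h hξ⟩
  choose V hV using hex
  have hdense : Dense (Prolate.eigenspan (Prolate.heunOp c) : Set Prolate.L2) := by
    rw [Submodule.dense_iff_topologicalClosure_eq_top,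
      Submodule.topologicalClosure_eq_top_iff, htotal]
  refine ⟨V, fun ξ hξ => (hV ξ ⟨hξ.1, hξ.2.le⟩).1, fun ξ hξ f hf => ?_, ?_⟩
  · exact Prolate.hasSum_polyApply_of_mem_eigenspan hc.ne' (by rw [abs_of_nonneg hξ.1]; exact hξ.2)
      (hV ξ ⟨hξ.1, hξ.2.le⟩).1 hf
  · refine Prolate.intervalIntegral_apply_of_dense zero_le_two (fun ξ => ?_)
      (fun ξ hξ => (hV ξ hξ).2) hdense fun f hf =>
        Prolate.finiteFourier_eq_integral_of_mem_eigenspan hc.ne' (fun ξ hξ => (hV ξ hξ).1) hf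
    have h := Prolate.norm_kernel c (1 - ξ) 1
    simpa using h
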